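/- Let $n$ be a non-negative integer and let $\rho:\mathbb{R}^n\to[0,1]$ be a $C^\infty$ function supported in the cube $\{\xi: -1\le \xi_i\le 1,\ i=1,\dots,n\}$ with $\rho(\xi)=1$ whenever $|\xi_i|\le \tfrac12$ for all $i$. For $k\in\mathbb{Z}^n$ put $$\sigma_k(\xi)=\rho(\xi-k)\Big(\sum_{j\in\mathbb{Z}^n}\rho(\xi-j)\Big)^{-1},\qquad \Box_k f=\mathcal{F}^{-1}(\sigma_k\,\mathcal{F}f)\quad (f\in\mathcal{S}'(\mathbb{R}^n)),$$ where $\mathcal{F}f(\xi)=(2\pi)^{-n/2}\int_{\mathbb{R}^n} f(x)e^{-ix\cdot\xi}\,dx$, extended to tempered distributions. For $s>0$, $0<p\le\infty$ and $1\le q\le\infty$, the Gevrey-modulation space $\mathcal{GM}^s_{p,q}(\mathbb{R}^n)$ consists of all $f\in L^p(\mathbb{R}^n)$ that define a tempered distribution by integration (which is automatic if $p\ge 1$) and satisfy $$\|f\|_{\mathcal{GM}^s_{p,q}}=\Big(\sum_{k\in\mathbb{Z}^n}e^{q|k|^{1/s}}\,\|\Box_k f\|_{L^p}^q\Big)^{1/q}<\infty$$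 (with $\sup_{k} e^{|k|^{1/s}}\|\Box_k f\|_{L^p}$ if $q=\infty$); here $|k|$ is the Euclidean length of $k$. **Theorem.** Let $s>1$ and $1\le q\le\infty$. There is a constant $C>0$, depending only on $\rho$, $n$, $s$ and $q$, such that for all $1\le p_1,p_2\le\infty$, with $p$ defined by $\frac1p=\frac1{p_1}+\frac1{p_2}$, and all $f\in\mathcal{GM}^s_{p_1,q}(\mathbb{R}^n)$, $g\in\mathcal{GM}^s_{p_2,q}(\mathbb{R}^n)$, the pointwise product satisfies $f\cdot g\in\mathcal{GM}^s_{p,q}(\mathbb{R}^n)$ and $$\|f\cdot g\|_{\mathcal{GM}^s_{p,q}}\le C\,\|f\|_{\mathcal{GM}^s_{p_1,q}}\,\|g\|_{\mathcal{GM}^s_{p_2,q}}.$$ -/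

import Mathlib

open MeasureTheory
open scoped ENNReal ContDiff SchwartzMap

namespace GevreyModulation

/-- A point of the lattice `ℤⁿ`, viewed as a point of Euclidean space `ℝⁿ`. -/
def latticePoint {n : ℕ} (k : Fin n → ℤ) : EuclideanSpace ℝ (Fin n) :=
  WithLp.toLp 2 fun i => (k i : ℝ)

/-- A window: a smooth function `ρ : ℝⁿ → [0, 1]` which is supported in the cube
`{ξ : -1 ≤ ξ_i ≤ 1}` and equal to `1` on the cube `{ξ : |ξ_i| ≤ 1/2}`. -/
structure IsWindow {n : ℕ} (ρ : EuclideanSpace ℝ (Fin n) → ℝ) : Prop where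
  smooth : ContDiff ℝ ∞ ρ
  nonneg : ∀ ξ, 0 ≤ ρ ξ
  le_one : ∀ ξ, ρ ξ ≤ 1
  support_subset : tsupport ρ ⊆ {ξ | ∀ i, -1 ≤ ξ i ∧ ξ i ≤ 1}
  eq_one : ∀ ξ, (∀ i, |ξ i| ≤ 1 / 2) → ρ ξ = 1

/-- The frequency-uniform decomposition of unity
`σ_k(ξ) = ρ(ξ - k) / ∑_{j ∈ ℤⁿ} ρ(ξ - j)`; for a window `ρ` the sum has finitely many
non-zero terms at every `ξ`, and it is at least `1`. -/
noncomputable def sigma {n : ℕ} (ρ : EuclideanSpace ℝ (Fin n) → ℝ) (k : Fin n → ℤ)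
    (ξ : EuclideanSpace ℝ (Fin n)) : ℝ :=
  ρ (ξ - latticePoint k) / ∑' j : Fin n → ℤ, ρ (ξ - latticePoint j)

/-- The uniform decomposition operator `□_k = 𝓕⁻¹ (σ_k 𝓕 ·)` on tempered distributions, where
`𝓕 f (ξ) = (2π)^(-n/2) ∫ f(x) e^(-i x·ξ) dx`. Mathlib's Fourier transform has the kernel
`e^(-2πi x·ξ)`, so that the frequency `ξ` above is `2π` times Mathlib's frequency variable. -/
noncomputable def box {n : ℕ} (ρ : EuclideanSpace ℝ (Fin n) → ℝ) (k : Fin n → ℤ) :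
    𝓢'(EuclideanSpace ℝ (Fin n), ℂ) →L[ℂ] 𝓢'(EuclideanSpace ℝ (Fin n), ℂ) :=
  TemperedDistribution.fourierMultiplierCLM ℂ
    (fun ξ => ((sigma ρ k ((2 * Real.pi) • ξ) : ℝ) : ℂ))

/-- The tempered distribution `u` is given by integration against the function `f`. -/
def Represents {n : ℕ} (f : EuclideanSpace ℝ (Fin n) → ℂ)
    (u : 𝓢'(EuclideanSpace ℝ (Fin n), ℂ)) : Prop :=
  ∀ φ : 𝓢(EuclideanSpace ℝ (Fin n), ℂ),
    Integrable (fun x => φ x * f x) ∧ u φ = ∫ x, φ x * f x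

/-- The `L^p` (quasi-)norm, in `[0, ∞]`, of a tempered distribution: the `L^p` norm of the function
that represents it (which is unique almost everywhere), and `∞` if no function does. -/
noncomputable def distLpNorm {n : ℕ} (p : ℝ≥0∞) (u : 𝓢'(EuclideanSpace ℝ (Fin n), ℂ)) : ℝ≥0∞ :=
  ⨅ (h : EuclideanSpace ℝ (Fin n) → ℂ) (_ : Represents h u), eLpNorm h p volume

/-- The `ℓ^q` norm, in `[0, ∞]`, of a family of elements of `[0, ∞]`. -/
noncomputable def seqNorm {ι : Type*} (q : ℝ≥0∞) (a : ι → ℝ≥0∞) : ℝ≥0∞ :=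
  if q = ⊤ then ⨆ k, a k else (∑' k, a k ^ q.toReal) ^ (1 / q.toReal)

/-- The norm `(∑_k e^(q |k|^(1/s)) ‖□_k u‖_{L^p}^q)^(1/q)` of a tempered distribution `u`,
with `|k|` the Euclidean length of `k`, and with the supremum over `k` if `q = ∞`. -/
noncomputable def distGevreyNorm {n : ℕ} (ρ : EuclideanSpace ℝ (Fin n) → ℝ) (s : ℝ) (p q : ℝ≥0∞)
    (u : 𝓢'(EuclideanSpace ℝ (Fin n), ℂ)) : ℝ≥0∞ :=
  seqNorm q fun k : Fin n → ℤ =>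
    ENNReal.ofReal (Real.exp (‖latticePoint k‖ ^ (1 / s))) * distLpNorm p (box ρ k u)

/-- The Gevrey-modulation norm of a function `f`: the norm of the tempered distribution which
`f` represents (at most one), and `∞` if `f` represents none. -/
noncomputable def gevreyNorm {n : ℕ} (ρ : EuclideanSpace ℝ (Fin n) → ℝ) (s : ℝ) (p q : ℝ≥0∞)
    (f : EuclideanSpace ℝ (Fin n) → ℂ) : ℝ≥0∞ :=
  ⨅ (u : 𝓢'(EuclideanSpace ℝ (Fin n), ℂ)) (_ : Represents f u), distGevreyNorm ρ s p q u

/-- Membership in the Gevrey-modulation space `𝓖𝓜^s_{p,q}(ℝⁿ)`, for the window `ρ`: functions in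
`L^p` with finite Gevrey-modulation norm. -/
def MemGevrey {n : ℕ} (ρ : EuclideanSpace ℝ (Fin n) → ℝ) (s : ℝ) (p q : ℝ≥0∞)
    (f : EuclideanSpace ℝ (Fin n) → ℂ) : Prop :=
  MemLp f p volume ∧ gevreyNorm ρ s p q f < ⊤

end GevreyModulation

/-! Write `f = ∑ □_k f` and `g = ∑ □_l g`. By Fourier supports, `□_m (□_k f · □_l g)` vanishes
unless every coordinate of `m - k - l` is at most `3` in absolute value
(`integral_kernel_mul_conv_mul_conv_eq_zero`). For such triples `|m| ≤ |k| + |l| + d`. Since `α =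
1/s < 1`, one has `(a + b)^α ≤ a^α + α b^α` when `b ≤ a`. So the weight at `m` is at most a constant
times the product of the weights at `k` and `l`, times a factor decaying like `e^(-(1-α)
min(|k|,|l|)^α)`, which is summable over the lattice (`exists_gevreyWeight_le`). Splitting this
factor into two equal halves, one half bounds the sum over the lower frequency and the other gives a
discrete convolution, controlled by Young's inequality (`tsum_tsum_cubeIndicator_le`).

The exponent `p` may be as small as `1/2`, where neither Minkowski's inequality nor the `L^p`
boundedness of `□_m` is at hand. Hence the frequency sums are estimated pointwise in `x`, before any
`L^p` norm is taken. A band-limited piece is reproduced by a Schwartz kernel, so it is controlled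
near `x` by its weighted average `smear` at `x`, and `□_m` of a product of pieces is bounded by a
product of two averages (`exists_enorm_integral_kernel_mul_le`). The outcome,
`exists_gevreyWeight_mul_enorm_conv_mul_le`, has just two products on the right. One quasi-triangle
inequality, Hölder, and Minkowski in `L^{p₁}` and `L^{p₂}` finish the proof, with constants
independent of the exponents.

The weights also force the suprema of the pieces to be summable. So `f` equals its series
(`Represents.ae_eq_tsum_conv`) and is bounded, whence `f g ∈ L^{p₂}` defines a tempered distribution
even when `p < 1`. -/

namespace GevreyModulation

/-! ### `L^p` inequalities for functions with values in `[0, ∞]`. -/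

section LpNorms

variable {α : Type*} {m : MeasurableSpace α} {μ : Measure α}

theorem eLpNorm_const_mul_ennreal {f : α → ℝ≥0∞} (hf : AEMeasurable f μ) (c p : ℝ≥0∞) :
    eLpNorm (fun x => c * f x) p μ = c * eLpNorm f p μ := by
  rcases eq_or_ne p 0 with rfl | h0
  · simp
  rcases eq_or_ne p ⊤ with rfl | ht
  · simp only [eLpNorm_exponent_top, eLpNormEssSup, enorm_eq_self]
    exact ENNReal.essSup_const_mul
  · have hp : 0 < p.toReal := ENNReal.toReal_pos h0 ht
    simp only [eLpNorm_eq_lintegral_rpow_enorm_toReal h0 ht, enorm_eq_self]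
    simp_rw [ENNReal.mul_rpow_of_nonneg _ _ hp.le]
    rw [lintegral_const_mul'' _ (hf.pow_const _), ENNReal.mul_rpow_of_nonneg _ _ (by positivity),
      ← ENNReal.rpow_mul, mul_one_div_cancel hp.ne', ENNReal.rpow_one]

theorem eLpNorm_mul_le_of_top {f g : α → ℝ≥0∞} (hg : AEMeasurable g μ) (p : ℝ≥0∞) :
    eLpNorm (fun x => f x * g x) p μ ≤ eLpNorm f ⊤ μ * eLpNorm g p μ := by
  rw [← eLpNorm_const_mul_ennreal hg]
  refine eLpNorm_mono_enorm_ae ?_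
  filter_upwards [ae_le_eLpNormEssSup (f := f) (μ := μ)] with x hx
  simp only [enorm_eq_self, eLpNorm_exponent_top] at hx ⊢
  gcongr

/-- Hölder's inequality for functions with values in `[0, ∞]`. -/
theorem eLpNorm_mul_le_ennreal {f g : α → ℝ≥0∞} (hf : AEMeasurable f μ) (hg : AEMeasurable g μ)
    {p q r : ℝ≥0∞} (hp : 1 ≤ p) (hq : 1 ≤ q) (hpqr : r⁻¹ = p⁻¹ + q⁻¹) :
    eLpNorm (fun x => f x * g x) r μ ≤ eLpNorm f p μ * eLpNorm g q μ := by
  rcases eq_or_ne p ⊤ with rfl | hpt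
  · obtain rfl : r = q := by simpa using hpqr
    exact eLpNorm_mul_le_of_top hg r
  rcases eq_or_ne q ⊤ with rfl | hqt
  · obtain rfl : r = p := by simpa using hpqr
    simp_rw [mul_comm (f _), mul_comm (eLpNorm f r μ)]
    exact eLpNorm_mul_le_of_top hf r
  have hp0 : p ≠ 0 := (zero_lt_one.trans_le hp).ne'
  have hq0 : q ≠ 0 := (zero_lt_one.trans_le hq).ne'
  have hr : r⁻¹ ≠ ⊤ := by rw [hpqr]; simp [hp0, hq0]
  have hr0 : r ≠ 0 := by simpa using hr
  have hrt : r ≠ ⊤ := by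
    rintro rfl
    simp only [ENNReal.inv_top] at hpqr
    have := (add_eq_zero.1 hpqr.symm).1
    simp [hpt] at this
  have hR : 1 / r.toReal = 1 / p.toReal + 1 / q.toReal := by
    have := congrArg ENNReal.toReal hpqr
    rw [ENNReal.toReal_add (by simp [hp0]) (by simp [hq0])] at this
    simpa [ENNReal.toReal_inv] using this
  have hrpos := ENNReal.toReal_pos hr0 hrt
  have hppos := ENNReal.toReal_pos hp0 hpt
  have hqpos := ENNReal.toReal_pos hq0 hqt
  have hlt : r.toReal < p.toReal := by
    have : 1 / p.toReal < 1 / r.toReal := by rw [hR]; simp [hqpos]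
    exact (one_div_lt_one_div hppos hrpos).1 this
  simp only [eLpNorm_eq_lintegral_rpow_enorm_toReal hr0 hrt,
    eLpNorm_eq_lintegral_rpow_enorm_toReal hp0 hpt,
    eLpNorm_eq_lintegral_rpow_enorm_toReal hq0 hqt, enorm_eq_self]
  exact ENNReal.lintegral_Lp_mul_le_Lq_mul_Lr hrpos hlt hR μ hf hg

/-- Minkowski for finite sums, then monotone convergence along the directed family of finite
subsets. -/
theorem eLpNorm_tsum_le {ι : Type*} [Countable ι] {f : ι → α → ℝ≥0∞}
    (hf : ∀ i, AEMeasurable (f i) μ) {p : ℝ≥0∞} (hp : 1 ≤ p) :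
    eLpNorm (fun x => ∑' i, f i x) p μ ≤ ∑' i, eLpNorm (f i) p μ := by
  rcases eq_or_ne p ⊤ with rfl | ht
  · simp only [eLpNorm_exponent_top]
    refine eLpNormEssSup_le_of_ae_enorm_bound ?_
    have : ∀ᵐ x ∂μ, ∀ i, ‖f i x‖ₑ ≤ eLpNormEssSup (f i) μ :=
      ae_all_iff.2 fun i => ae_le_eLpNormEssSup
    filter_upwards [this] with x hx
    simp only [enorm_eq_self] at hx ⊢
    exact ENNReal.tsum_le_tsum hx
  have h0 : p ≠ 0 := (zero_lt_one.trans_le hp).ne'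
  have hpos := ENNReal.toReal_pos h0 ht
  have hsum : ∀ s : Finset ι, eLpNorm (fun x => ∑ i ∈ s, f i x) p μ ≤ ∑' i, eLpNorm (f i) p μ := by
    intro s
    refine le_trans ?_ (ENNReal.sum_le_tsum s)
    have := eLpNorm_sum_le (μ := μ) (s := s) (f := f) (p := p)
      (fun i _ => (hf i).aestronglyMeasurable) hp
    rwa [show (∑ i ∈ s, f i) = fun x => ∑ i ∈ s, f i x from by ext x; simp] at this
  rw [eLpNorm_eq_lintegral_rpow_enorm_toReal h0 ht]
  simp only [enorm_eq_self]
  rw [one_div, ENNReal.rpow_inv_le_iff hpos]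
  have hsup : ∀ x, (∑' i, f i x) ^ p.toReal = ⨆ s : Finset ι, (∑ i ∈ s, f i x) ^ p.toReal := by
    intro x
    rw [ENNReal.tsum_eq_iSup_sum]
    exact (ENNReal.orderIsoRpow p.toReal hpos).map_iSup _
  simp_rw [hsup]
  rw [lintegral_iSup_directed]
  · refine iSup_le fun s => ?_
    have := hsum s
    rw [eLpNorm_eq_lintegral_rpow_enorm_toReal h0 ht] at this
    simp only [enorm_eq_self] at this
    rwa [one_div, ENNReal.rpow_inv_le_iff hpos] at this
  · exact fun s => (Finset.aemeasurable_fun_sum s fun i _ => hf i).pow_const _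
  · refine directed_of_isDirected_le fun s t hst x => ?_
    exact ENNReal.rpow_le_rpow (Finset.sum_le_sum_of_subset hst) hpos.le

/-- For `p < 1` the quasi-triangle constant is `2 ^ (1 / p - 1)`, which the bound on `p⁻¹` keeps
below `2`, uniformly in `p`. -/
theorem eLpNorm_add_le_two_mul {f g : α → ℝ≥0∞} (hf : AEMeasurable f μ) (hg : AEMeasurable g μ)
    {p : ℝ≥0∞} (hp : p⁻¹ ≤ 2) :
    eLpNorm (fun x => f x + g x) p μ ≤ 2 * (eLpNorm f p μ + eLpNorm g p μ) := by
  refine (eLpNorm_add_le' hf.aestronglyMeasurable hg.aestronglyMeasurable p).trans ?_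
  gcongr
  rw [ENNReal.LpAddConst]
  split_ifs with h
  · have h2 : (1 / p.toReal - 1) ≤ 1 := by
      have := ENNReal.toReal_mono (by simp) hp
      rw [ENNReal.toReal_inv] at this
      norm_num at this ⊢
      linarith
    calc (2 : ℝ≥0∞) ^ (1 / p.toReal - 1) ≤ 2 ^ (1 : ℝ) :=
          ENNReal.rpow_le_rpow_of_exponent_le (by norm_num) h2
      _ = 2 := by simp
  · norm_num

/-- Schur's test for a kernel whose row and column masses have a common bound. -/
theorem eLpNorm_lintegral_kernel_le [SFinite μ] {κ : α → α → ℝ≥0∞}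
    (hκ : Measurable (Function.uncurry κ)) {f : α → ℝ≥0∞} (hf : AEMeasurable f μ) {M : ℝ≥0∞}
    (h₁ : ∀ x, ∫⁻ y, κ x y ∂μ ≤ M) (h₂ : ∀ y, ∫⁻ x, κ x y ∂μ ≤ M) {p : ℝ≥0∞} (hp : 1 ≤ p) :
    eLpNorm (fun x => ∫⁻ y, κ x y * f y ∂μ) p μ ≤ M * eLpNorm f p μ := by
  have hκx : ∀ x, Measurable (κ x) := fun x => hκ.comp measurable_prodMk_left
  have hκy : ∀ y, Measurable (fun x => κ x y) := fun y => hκ.comp measurable_prodMk_right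
  rcases eq_or_ne p ⊤ with rfl | ht
  · simp only [eLpNorm_exponent_top]
    refine eLpNormEssSup_le_of_ae_enorm_bound (.of_forall fun x => ?_)
    simp only [enorm_eq_self]
    calc ∫⁻ y, κ x y * f y ∂μ ≤ ∫⁻ y, κ x y * eLpNormEssSup f μ ∂μ := by
          refine lintegral_mono_ae ?_
          filter_upwards [ae_le_eLpNormEssSup (f := f) (μ := μ)] with y hy
          simp only [enorm_eq_self] at hy
          gcongr
      _ = (∫⁻ y, κ x y ∂μ) * eLpNormEssSup f μ := lintegral_mul_const _ (hκx x)
      _ ≤ _ := by gcongr; exact h₁ x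
  have h0 : p ≠ 0 := (zero_lt_one.trans_le hp).ne'
  have hpos := ENNReal.toReal_pos h0 ht
  have hp1 : 1 ≤ p.toReal := by simpa using ENNReal.toReal_mono ht hp
  -- Hölder for the splitting `κ f = (κ^(1/p) f) · κ^(1/p')` uses the row masses; the column masses
  -- enter later, through Tonelli.
  have key : ∀ x, (∫⁻ y, κ x y * f y ∂μ) ^ p.toReal
      ≤ M ^ (p.toReal - 1) * ∫⁻ y, κ x y * f y ^ p.toReal ∂μ := by
    intro x
    rcases hp1.eq_or_lt with h1 | h1
    · simp [← h1]
    have hc : p.toReal.HolderConjugate (Real.conjExponent p.toReal) :=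
      Real.HolderConjugate.conjExponent h1
    set c := Real.conjExponent p.toReal
    have hcpos : 0 < c := hc.symm.pos
    have hH := ENNReal.lintegral_mul_le_Lp_mul_Lq μ hc
      (f := fun y => κ x y ^ (1 / p.toReal) * f y) (g := fun y => κ x y ^ (1 / c))
      (((hκx x).pow_const _).aemeasurable.mul hf) ((hκx x).pow_const _).aemeasurable
    have e1 : ∀ y, ((fun y => κ x y ^ (1 / p.toReal) * f y) * fun y => κ x y ^ (1 / c)) y
        = κ x y * f y := by
      intro y
      simp only [Pi.mul_apply]
      rw [mul_right_comm, ← ENNReal.rpow_add_of_nonneg _ _ (by positivity) (by positivity)]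
      rw [one_div, one_div, hc.inv_add_inv_eq_one, ENNReal.rpow_one]
    have e2 : ∀ y, (κ x y ^ (1 / p.toReal) * f y) ^ p.toReal = κ x y * f y ^ p.toReal := by
      intro y
      rw [ENNReal.mul_rpow_of_nonneg _ _ hpos.le, ← ENNReal.rpow_mul, one_div_mul_cancel hpos.ne',
        ENNReal.rpow_one]
    have e3 : ∀ y, (κ x y ^ (1 / c)) ^ c = κ x y := by
      intro y
      rw [← ENNReal.rpow_mul, one_div_mul_cancel hcpos.ne', ENNReal.rpow_one]
    simp_rw [e1, e2, e3] at hH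
    calc (∫⁻ y, κ x y * f y ∂μ) ^ p.toReal
        ≤ ((∫⁻ y, κ x y * f y ^ p.toReal ∂μ) ^ (1 / p.toReal)
            * (∫⁻ y, κ x y ∂μ) ^ (1 / c)) ^ p.toReal := by gcongr
      _ ≤ ((∫⁻ y, κ x y * f y ^ p.toReal ∂μ) ^ (1 / p.toReal) * M ^ (1 / c)) ^ p.toReal := by
          gcongr; exact h₁ x
      _ = M ^ (p.toReal - 1) * ∫⁻ y, κ x y * f y ^ p.toReal ∂μ := by
          rw [ENNReal.mul_rpow_of_nonneg _ _ hpos.le, ← ENNReal.rpow_mul, ← ENNReal.rpow_mul,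
            one_div_mul_cancel hpos.ne', ENNReal.rpow_one, mul_comm]
          congr 2
          have := hc.inv_add_inv_eq_one
          have h3 : 1 / c = 1 - 1 / p.toReal := by rw [one_div, one_div]; linarith
          rw [h3]; field_simp
  rw [eLpNorm_eq_lintegral_rpow_enorm_toReal h0 ht, eLpNorm_eq_lintegral_rpow_enorm_toReal h0 ht]
  simp only [enorm_eq_self]
  rw [one_div, ENNReal.rpow_inv_le_iff hpos, ENNReal.mul_rpow_of_nonneg _ _ hpos.le,
    ← ENNReal.rpow_mul, inv_mul_cancel₀ hpos.ne', ENNReal.rpow_one]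
  have hm : AEMeasurable (Function.uncurry fun x y => κ x y * f y ^ p.toReal) (μ.prod μ) :=
    hκ.aemeasurable.mul (hf.comp_snd.pow_const _)
  calc ∫⁻ x, (∫⁻ y, κ x y * f y ∂μ) ^ p.toReal ∂μ
      ≤ ∫⁻ x, M ^ (p.toReal - 1) * ∫⁻ y, κ x y * f y ^ p.toReal ∂μ ∂μ := lintegral_mono key
    _ = M ^ (p.toReal - 1) * ∫⁻ x, ∫⁻ y, κ x y * f y ^ p.toReal ∂μ ∂μ :=
        lintegral_const_mul'' _ hm.lintegral_prod_right'
    _ = M ^ (p.toReal - 1) * ∫⁻ y, ∫⁻ x, κ x y * f y ^ p.toReal ∂μ ∂μ := by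
        rw [lintegral_lintegral_swap hm]
    _ ≤ M ^ (p.toReal - 1) * ∫⁻ y, M * f y ^ p.toReal ∂μ := by
        gcongr with y
        rw [lintegral_mul_const _ (hκy y)]
        gcongr
        exact h₂ y
    _ = M ^ p.toReal * ∫⁻ y, f y ^ p.toReal ∂μ := by
        rw [lintegral_const_mul'' _ (hf.pow_const _), ← mul_assoc]
        congr 1
        nth_rw 2 [← ENNReal.rpow_one M]
        rw [← ENNReal.rpow_add_of_nonneg _ _ (by linarith) zero_le_one, sub_add_cancel]

end LpNorms

/-! ### `ℓ^q` norms as `L^q` norms for counting measure. -/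

section SequenceNorms

variable {ι : Type*}

theorem seqNorm_eq_eLpNorm_count [MeasurableSpace ι] [MeasurableSingletonClass ι] [Countable ι]
    {q : ℝ≥0∞} (hq : 1 ≤ q) (a : ι → ℝ≥0∞) : seqNorm q a = eLpNorm a q Measure.count := by
  have h0 : q ≠ 0 := (zero_lt_one.trans_le hq).ne'
  rw [seqNorm]
  split_ifs with h
  · subst h
    simp
  · rw [eLpNorm_eq_lintegral_rpow_enorm_toReal h0 h, lintegral_count]
    simp

theorem le_seqNorm {q : ℝ≥0∞} (hq : 1 ≤ q) (a : ι → ℝ≥0∞) (i : ι) : a i ≤ seqNorm q a := by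
  rw [seqNorm]
  split_ifs with h
  · exact le_iSup a i
  · have hpos := ENNReal.toReal_pos (zero_lt_one.trans_le hq).ne' h
    rw [one_div, ENNReal.le_rpow_inv_iff hpos]
    exact ENNReal.le_tsum (f := fun k => a k ^ q.toReal) i

theorem seqNorm_comp_equiv (q : ℝ≥0∞) (a : ι → ℝ≥0∞) (e : ι ≃ ι) :
    seqNorm q (fun i => a (e i)) = seqNorm q a := by
  rw [seqNorm, seqNorm, e.iSup_comp (g := a), e.tsum_eq (fun k => a k ^ q.toReal)]

theorem seqNorm_mono {q : ℝ≥0∞} {a b : ι → ℝ≥0∞} (h : ∀ i, a i ≤ b i) :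
    seqNorm q a ≤ seqNorm q b := by
  rw [seqNorm, seqNorm]
  split_ifs
  · exact iSup_mono h
  · gcongr with i
    exact h i

theorem seqNorm_const_mul [Countable ι] {q : ℝ≥0∞} (hq : 1 ≤ q) (c : ℝ≥0∞) (a : ι → ℝ≥0∞) :
    seqNorm q (fun i => c * a i) = c * seqNorm q a := by
  let _ : MeasurableSpace ι := ⊤
  have : MeasurableSingletonClass ι := ⟨fun _ => trivial⟩
  rw [seqNorm_eq_eLpNorm_count hq, seqNorm_eq_eLpNorm_count hq]
  exact eLpNorm_const_mul_ennreal (measurable_from_top).aemeasurable c q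

theorem seqNorm_tsum_le [Countable ι] {κ : Type*} [Countable κ] {q : ℝ≥0∞} (hq : 1 ≤ q)
    (a : κ → ι → ℝ≥0∞) : seqNorm q (fun i => ∑' k, a k i) ≤ ∑' k, seqNorm q (a k) := by
  let _ : MeasurableSpace ι := ⊤
  have : MeasurableSingletonClass ι := ⟨fun _ => trivial⟩
  simp_rw [seqNorm_eq_eLpNorm_count hq]
  exact eLpNorm_tsum_le (fun k => (measurable_from_top).aemeasurable) hq

theorem seqNorm_add_le [Countable ι] {q : ℝ≥0∞} (hq : 1 ≤ q) (a b : ι → ℝ≥0∞) :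
    seqNorm q (fun i => a i + b i) ≤ seqNorm q a + seqNorm q b := by
  let _ : MeasurableSpace ι := ⊤
  have : MeasurableSingletonClass ι := ⟨fun _ => trivial⟩
  simp_rw [seqNorm_eq_eLpNorm_count hq]
  exact eLpNorm_add_le (measurable_from_top).aestronglyMeasurable
    (measurable_from_top).aestronglyMeasurable hq

end SequenceNorms

/-! ### The polynomial weight and convolution with Schwartz kernels. -/

section Weights

variable {V : Type*} [NormedAddCommGroup V] [InnerProductSpace ℝ V]

/-- The integrable polynomial weight `(1 + |x|)^(-(d + 1))` on a `d`-dimensional space. -/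
noncomputable def weight (x : V) : ℝ := ((1 + ‖x‖) ^ (Module.finrank ℝ V + 1))⁻¹

theorem weight_pos (x : V) : 0 < weight x := by
  unfold weight
  positivity

theorem weight_le_one (x : V) : weight x ≤ 1 :=
  inv_le_one_of_one_le₀ (one_le_pow₀ (by linarith [norm_nonneg x]))

theorem weight_neg (x : V) : weight (-x) = weight x := by
  simp [weight]

theorem weight_sub_comm (x y : V) : weight (x - y) = weight (y - x) := by
  simp [weight, norm_sub_rev]

@[fun_prop]
theorem continuous_weight : Continuous (weight : V → ℝ) := by
  unfold weight
  refine Continuous.inv₀ (by fun_prop) fun x => ?_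
  positivity

/-- A power of `1 + |x + y| ≤ (1 + |x|) (1 + |y|)`: recentring the weight costs only one inverse
weight. -/
theorem weight_mul_weight_le (x y : V) : weight x * weight y ≤ weight (x + y) := by
  unfold weight
  rw [← mul_inv, ← mul_pow]
  gcongr
  nlinarith [norm_add_le x y, norm_nonneg x, norm_nonneg y, mul_nonneg (norm_nonneg x)
    (norm_nonneg y)]

theorem weight_sub_le (y z : V) : weight (y - z) ≤ (weight y)⁻¹ * weight z := by
  rw [inv_mul_eq_div, le_div_iff₀ (weight_pos y)]
  have := weight_mul_weight_le (z - y) y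
  rwa [sub_add_cancel, weight_sub_comm] at this

theorem exists_norm_le_weight_pow (K : 𝓢(V, ℂ)) (m : ℕ) :
    ∃ C : ℝ, 0 ≤ C ∧ ∀ x, ‖K x‖ ≤ C * weight x ^ m := by
  set N := (Module.finrank ℝ V + 1) * m
  refine ⟨2 ^ N * ((Finset.Iic (N, 0)).sup fun m => SchwartzMap.seminorm ℝ m.1 m.2) K,
    by positivity, fun x => ?_⟩
  have := SchwartzMap.one_add_le_sup_seminorm_apply (𝕜 := ℝ) (m := (N, 0)) le_rfl le_rfl K x
  rw [norm_iteratedFDeriv_zero] at this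
  rw [weight, inv_pow, ← pow_mul, ← div_eq_mul_inv, le_div_iff₀ (by positivity), mul_comm]
  exact this

theorem exists_norm_le_weight (K : 𝓢(V, ℂ)) :
    ∃ C : ℝ, 0 ≤ C ∧ ∀ x, ‖K x‖ ≤ C * weight x := by
  simpa using exists_norm_le_weight_pow K 1

variable [FiniteDimensional ℝ V] [MeasurableSpace V] [BorelSpace V]

theorem integrable_weight : Integrable (weight : V → ℝ) := by
  have := integrable_one_add_norm (E := V) (μ := volume) (r := (Module.finrank ℝ V + 1 : ℕ))
    (by push_cast; linarith)
  refine this.congr (.of_forall fun x => ?_)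
  simp only [weight]
  rw [Real.rpow_neg (by positivity), Real.rpow_natCast]

/-- Functions which are integrable against the polynomial weight. -/
def Tame (f : V → ℂ) : Prop := Integrable fun x => (weight x : ℂ) * f x

theorem Tame.aestronglyMeasurable {f : V → ℂ} (hf : Tame f) : AEStronglyMeasurable f := by
  have h : AEStronglyMeasurable (fun x : V => ((weight x : ℂ))⁻¹) :=
    (Continuous.inv₀ (by fun_prop) fun x => by
      exact_mod_cast (weight_pos x).ne').aestronglyMeasurable
  refine (h.mul (Integrable.aestronglyMeasurable hf)).congr (.of_forall fun x => ?_)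
  have : (weight x : ℂ) ≠ 0 := by exact_mod_cast (weight_pos x).ne'
  simp [this]

theorem Tame.integrable_mul {f S : V → ℂ} (hf : Tame f) (hS : AEStronglyMeasurable S) {C : ℝ}
    (hC : ∀ y, ‖S y‖ ≤ C * weight y) : Integrable fun y => S y * f y := by
  refine (hf.norm.const_mul C).mono' (hS.mul hf.aestronglyMeasurable) (.of_forall fun y => ?_)
  rw [norm_mul, norm_mul, Complex.norm_real, Real.norm_of_nonneg (weight_pos y).le, ← mul_assoc]
  gcongr
  exact hC y

theorem Tame.sub {f g : V → ℂ} (hf : Tame f) (hg : Tame g) : Tame fun x => f x - g x := by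
  refine (Integrable.sub hf hg).congr (.of_forall fun x => ?_)
  simp [mul_sub]

theorem memLp_weight (p : ℝ≥0∞) (hp : 1 ≤ p) : MemLp (fun x : V => (weight x : ℂ)) p := by
  have h1 : MemLp (fun x : V => (weight x : ℂ)) 1 :=
    memLp_one_iff_integrable.2 integrable_weight.ofReal
  have ht : MemLp (fun x : V => (weight x : ℂ)) ⊤ :=
    memLp_top_of_bound (by fun_prop) 1 (.of_forall fun x => by
      rw [Complex.norm_real, Real.norm_of_nonneg (weight_pos x).le]
      exact weight_le_one x)
  rcases eq_or_ne p ⊤ with rfl | hpt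
  · exact ht
  · have h0 : p ≠ 0 := (zero_lt_one.trans_le hp).ne'
    rw [← integrable_norm_rpow_iff h1.1 h0 hpt]
    refine (integrable_weight (V := V)).mono' (by fun_prop (disch := simp)) (.of_forall fun x => ?_)
    have hp1 : 1 ≤ p.toReal := by simpa using ENNReal.toReal_mono hpt hp
    rw [Complex.norm_real, Real.norm_of_nonneg (weight_pos x).le,
      Real.norm_of_nonneg (Real.rpow_nonneg (weight_pos x).le _)]
    exact (Real.rpow_le_rpow_of_exponent_ge (weight_pos x) (weight_le_one x) hp1).trans
      (Real.rpow_one _).le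

/-- Hölder: the weight is bounded and integrable, hence lies in the dual `L^{p'}`. -/
theorem Tame.of_memLp {f : V → ℂ} {p : ℝ≥0∞} (hp : 1 ≤ p) (hf : MemLp f p) : Tame f := by
  have := ENNReal.HolderConjugate.inv_one_sub_inv' hp
  have hc : ENNReal.HolderTriple (1 - p⁻¹)⁻¹ p 1 := ENNReal.HolderTriple.symm
  exact memLp_one_iff_integrable.1 (hf.mul' (memLp_weight (1 - p⁻¹)⁻¹ (by simp)))

/-- The convolution `∫ K(x - y) f(y) dy`. -/
noncomputable def conv (K f : V → ℂ) (x : V) : ℂ := ∫ y, K (x - y) * f y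

theorem Tame.exists_norm_conv_le {f : V → ℂ} (hf : Tame f) (K : 𝓢(V, ℂ)) :
    ∃ C : ℝ, 0 ≤ C ∧ ∀ x, ‖conv K f x‖ ≤ C * (weight x)⁻¹ := by
  obtain ⟨C, hC, h⟩ := exists_norm_le_weight K
  refine ⟨C * ∫ y, ‖(weight y : ℂ) * f y‖, by positivity, fun x => ?_⟩
  calc ‖conv K f x‖ ≤ ∫ y, (C * (weight x)⁻¹) * ‖(weight y : ℂ) * f y‖ := by
        refine norm_integral_le_of_norm_le (hf.norm.const_mul _) (.of_forall fun y => ?_)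
        rw [norm_mul, norm_mul, Complex.norm_real, Real.norm_of_nonneg (weight_pos y).le,
          ← mul_assoc]
        gcongr
        rw [mul_assoc]
        exact (h _).trans (by gcongr; exact weight_sub_le x y)
    _ = _ := by rw [integral_const_mul]; ring

theorem aestronglyMeasurable_conv {K f : V → ℂ} (hK : Continuous K)
    (hf : AEStronglyMeasurable f) : AEStronglyMeasurable (conv K f) := by
  have : AEStronglyMeasurable (fun p : V × V => K (p.1 - p.2) * f p.2) (volume.prod volume) :=
    (hK.comp (by fun_prop)).aestronglyMeasurable.mul hf.comp_snd
  exact this.integral_prod_right'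

/-- Fubini's theorem for a rapidly decreasing function tested against a convolution. -/
theorem Tame.integral_mul_conv {f S : V → ℂ} (hf : Tame f) (K : 𝓢(V, ℂ))
    (hS : AEStronglyMeasurable S) {C : ℝ} (hC : ∀ y, ‖S y‖ ≤ C * weight y ^ 2) :
    ∫ y, S y * conv K f y = ∫ z, (∫ y, S y * K (y - z)) * f z := by
  obtain ⟨B, hB, h⟩ := exists_norm_le_weight K
  have hint : Integrable (Function.uncurry fun y z => S y * (K (y - z) * f z))
      (volume.prod volume) := by
    -- Of the two powers of `weight y`, one cancels the loss in `weight_sub_le` and the other gives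
    -- integrability in `y`.
    refine ((integrable_weight (V := V)).mul_prod (hf.norm.const_mul (C * B))).mono' ?_ ?_
    · exact hS.comp_fst.mul ((K.continuous.comp (by fun_prop)).aestronglyMeasurable.mul
        hf.aestronglyMeasurable.comp_snd)
    · refine .of_forall fun ⟨y, z⟩ => ?_
      have hC0 : 0 ≤ C * weight y ^ 2 := (norm_nonneg _).trans (hC y)
      have h1 : ‖S y‖ * ‖K (y - z)‖ ≤ (C * weight y ^ 2) * (B * ((weight y)⁻¹ * weight z)) :=
        mul_le_mul (hC y) ((h _).trans (by gcongr; exact weight_sub_le y z)) (norm_nonneg _) hC0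
      have h2 : (C * weight y ^ 2) * (B * ((weight y)⁻¹ * weight z))
          = weight y * (C * B * weight z) := by
        have := (weight_pos y).ne'
        field_simp
      simp only [Function.uncurry, norm_mul, Complex.norm_real,
        Real.norm_of_nonneg (weight_pos z).le]
      calc ‖S y‖ * (‖K (y - z)‖ * ‖f z‖) = (‖S y‖ * ‖K (y - z)‖) * ‖f z‖ := by ring
        _ ≤ (weight y * (C * B * weight z)) * ‖f z‖ := by
          rw [← h2]; gcongr
        _ = _ := by ring
  calc ∫ y, S y * conv K f y = ∫ y, ∫ z, S y * (K (y - z) * f z) := by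
        simp_rw [conv, integral_const_mul]
    _ = ∫ z, ∫ y, S y * (K (y - z) * f z) := integral_integral_swap hint
    _ = _ := by simp_rw [← mul_assoc, integral_mul_const]

end Weights

/-! ### Fourier identities for kernels, and band-limited test functions. -/

section FourierIdentities

open FourierTransform Real
open scoped RealInnerProductSpace

variable {V : Type*} [NormedAddCommGroup V] [InnerProductSpace ℝ V] [FiniteDimensional ℝ V]
  [MeasurableSpace V] [BorelSpace V]

theorem fourier_apply_eq_integral (f : 𝓢(V, ℂ)) (ξ : V) :
    𝓕 f ξ = ∫ v, 𝐞 (-⟪v, ξ⟫) • f v := rfl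

theorem fourierInv_apply_eq_integral (f : 𝓢(V, ℂ)) (ξ : V) :
    𝓕⁻ f ξ = ∫ v, 𝐞 ⟪v, ξ⟫ • f v := by
  rw [SchwartzMap.fourierInv_coe, Real.fourierInv_eq]

theorem fourier_compSubConst (f : 𝓢(V, ℂ)) (a ξ : V) :
    𝓕 (SchwartzMap.compSubConstCLM ℂ a f) ξ = 𝐞 (-⟪a, ξ⟫) • 𝓕 f ξ := by
  rw [fourier_apply_eq_integral, fourier_apply_eq_integral, Circle.smul_def, ← integral_smul,
    ← integral_add_right_eq_self _ a]
  refine integral_congr_ae (.of_forall fun v => ?_)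
  simp only [SchwartzMap.compSubConstCLM_apply, add_sub_cancel_right]
  rw [← Circle.smul_def, smul_smul, ← AddChar.map_add_eq_mul]
  congr 2
  rw [inner_add_left]
  ring

theorem fourierInv_eq_fourier_neg (f : 𝓢(V, ℂ)) (ξ : V) : 𝓕⁻ f ξ = 𝓕 f (-ξ) := by
  rw [SchwartzMap.fourierInv_coe, Real.fourierInv_eq_fourier_neg, SchwartzMap.fourier_coe]

theorem fourierInv_compSubConst (f : 𝓢(V, ℂ)) (a ξ : V) :
    𝓕⁻ (SchwartzMap.compSubConstCLM ℂ a f) ξ = 𝐞 ⟪a, ξ⟫ • 𝓕⁻ f ξ := by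
  rw [fourierInv_eq_fourier_neg, fourierInv_eq_fourier_neg, fourier_compSubConst, inner_neg_right,
    neg_neg]

theorem fourierInv_fourierInv (f : 𝓢(V, ℂ)) (ξ : V) : 𝓕⁻ (𝓕⁻ f) ξ = f (-ξ) := by
  rw [fourierInv_eq_fourier_neg, FourierInvPair.fourier_fourierInv_eq]

/-- Testing a translate of `𝓕⁻ σ` amounts to applying the Fourier multiplier `σ`. -/
theorem integral_mul_fourierInv_sub (σ φ : 𝓢(V, ℂ)) (z : V) :
    ∫ y, φ y * 𝓕⁻ σ (y - z) = ∫ ξ, 𝐞 (-⟪ξ, z⟫) • (σ ξ * 𝓕⁻ φ ξ) := by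
  have h := SchwartzMap.integral_fourierInv_mul_eq φ
    (𝓕 (SchwartzMap.compSubConstCLM ℂ z (𝓕⁻ σ)))
  rw [FourierPair.fourierInv_fourier_eq] at h
  simp only [SchwartzMap.compSubConstCLM_apply] at h
  rw [← h]
  refine integral_congr_ae (.of_forall fun ξ => ?_)
  simp only
  rw [fourier_compSubConst, FourierInvPair.fourier_fourierInv_eq, Circle.smul_def, Circle.smul_def,
    real_inner_comm]
  simp only [smul_eq_mul]
  ring

theorem fourierInv_sub_eq (σ : 𝓢(V, ℂ)) (x y : V) :
    𝓕⁻ σ (x - y) = SchwartzMap.compSubConstCLM ℂ x (𝓕 σ) y := by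
  rw [fourierInv_eq_fourier_neg, SchwartzMap.compSubConstCLM_apply, neg_sub]

/-- Convolving kernels multiplies their symbols. This yields the reproducing formula for
band-limited pieces. -/
theorem integral_fourierInv_sub_mul_fourierInv_sub {χ σ : 𝓢(V, ℂ)} (h : ∀ ξ, χ ξ * σ ξ = σ ξ)
    (x z : V) : ∫ y, 𝓕⁻ χ (x - y) * 𝓕⁻ σ (y - z) = 𝓕⁻ σ (x - z) := by
  simp_rw [fourierInv_sub_eq χ x]
  rw [integral_mul_fourierInv_sub, fourierInv_apply_eq_integral]
  refine integral_congr_ae (.of_forall fun ξ => ?_)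
  simp only
  rw [fourierInv_compSubConst, FourierPair.fourierInv_fourier_eq, Circle.smul_def,
    Circle.smul_def, Circle.smul_def, inner_sub_right, sub_eq_add_neg, AddChar.map_add_eq_mul,
    real_inner_comm ξ x]
  simp only [smul_eq_mul, Circle.coe_mul]
  calc _ = (𝐞 (-⟪ξ, z⟫) : ℂ) * (𝐞 ⟪ξ, x⟫ : ℂ) * (χ ξ * σ ξ) := by ring
    _ = _ := by rw [h]; ring

/-- The product of two functions with Fourier supports in `A` and `B` has no frequency outside
`A + B`. -/
theorem integral_fourierInv_mul_mul_eq_zero {σ₀ σ₁ σ₂ : 𝓢(V, ℂ)}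
    (h : ∀ t η, σ₀ t * σ₁ (t - η) * σ₂ η = 0) (x z w : V) :
    ∫ y, 𝓕⁻ σ₀ (x - y) * 𝓕⁻ σ₁ (y - z) * 𝓕⁻ σ₂ (y - w) = 0 := by
  set φ₀ := SchwartzMap.compSubConstCLM ℂ x (𝓕 σ₀)
  set φ₁ := SchwartzMap.compSubConstCLM ℂ z (𝓕⁻ σ₁)
  set S := SchwartzMap.pairing (ContinuousLinearMap.mul ℂ ℂ) φ₀ φ₁
  have hS : ∀ y, 𝓕⁻ σ₀ (x - y) * 𝓕⁻ σ₁ (y - z) = S y := fun y => by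
    rw [fourierInv_sub_eq]
    simp [S, φ₀, φ₁]
  simp_rw [hS]
  rw [integral_mul_fourierInv_sub]
  have key : 𝓕⁻ S = SchwartzMap.convolution (ContinuousLinearMap.mul ℂ ℂ) (𝓕⁻ φ₀) (𝓕⁻ φ₁) := by
    have := SchwartzMap.fourier_convolution (ContinuousLinearMap.mul ℂ ℂ) (𝓕⁻ φ₀) (𝓕⁻ φ₁)
    rw [FourierInvPair.fourier_fourierInv_eq, FourierInvPair.fourier_fourierInv_eq] at this
    rw [show S = _ from this.symm, FourierPair.fourierInv_fourier_eq]
  rw [integral_eq_zero_of_ae]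
  refine .of_forall fun η => ?_
  simp only [Pi.zero_apply]
  -- `𝓕⁻ S η` is an integral over `t` whose integrand contains `σ₀ t * σ₁ (t - η)`, so the factor
  -- `σ₂ η` kills it pointwise.
  have : σ₂ η * 𝓕⁻ S η = 0 := by
    rw [key, SchwartzMap.convolution_apply, MeasureTheory.convolution_def, ← integral_const_mul,
      integral_eq_zero_of_ae]
    refine .of_forall fun t => ?_
    have h1 : 𝓕⁻ φ₀ t = 𝐞 ⟪x, t⟫ • σ₀ t := by
      simp only [φ₀]
      rw [fourierInv_compSubConst, FourierPair.fourierInv_fourier_eq]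
    have h2 : 𝓕⁻ φ₁ (η - t) = 𝐞 ⟪z, η - t⟫ • σ₁ (t - η) := by
      simp only [φ₁]
      rw [fourierInv_compSubConst, fourierInv_fourierInv, neg_sub]
    simp only [ContinuousLinearMap.mul_apply', h1, h2, Circle.smul_def, smul_eq_mul,
      Pi.zero_apply]
    calc _ = (𝐞 ⟪x, t⟫ : ℂ) * (𝐞 ⟪z, η - t⟫ : ℂ) * (σ₀ t * σ₁ (t - η) * σ₂ η) := by ring
      _ = 0 := by rw [h, mul_zero]
  rw [this, smul_zero]

/-- Translating a symbol multiplies its kernel by a unimodular character. Hence all kernel bounds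
are uniform in `k`. -/
theorem norm_fourierInv_eq_of_translate {σ τ : 𝓢(V, ℂ)} {a : V} (h : ∀ ξ, τ ξ = σ (ξ - a))
    (x : V) : ‖𝓕⁻ τ x‖ = ‖𝓕⁻ σ x‖ := by
  have : τ = SchwartzMap.compSubConstCLM ℂ a σ := by
    ext ξ
    rw [h, SchwartzMap.compSubConstCLM_apply]
  rw [this, fourierInv_compSubConst, Circle.norm_smul]

/-- Produces band-limited approximations: if `𝓕 Ψ` has compact support, so does `θ · 𝓕 Ψ (a • ·)`
for `a ≠ 0`. -/
theorem integral_fourier_dilate_mul (θ Ψ : 𝓢(V, ℂ)) (z : V) (a : ℝ) :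
    ∫ t, 𝓕 θ (z + a • t) * Ψ t = ∫ ξ, 𝐞 (-⟪ξ, z⟫) • (θ ξ * 𝓕 Ψ (a • ξ)) := by
  have hint : Integrable (Function.uncurry fun t ξ => (𝐞 (-⟪ξ, z + a • t⟫) • θ ξ) * Ψ t)
      (volume.prod volume) := by
    refine (Ψ.integrable.norm.mul_prod θ.integrable.norm).mono' ?_ ?_
    · refine Continuous.aestronglyMeasurable ?_
      have := Real.continuous_fourierChar
      have h1 := θ.continuous
      have h2 := Ψ.continuous
      simp only [Function.uncurry_def, Circle.smul_def]
      fun_prop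
    · exact .of_forall fun p => by simp [Function.uncurry, mul_comm]
  calc ∫ t, 𝓕 θ (z + a • t) * Ψ t
      = ∫ t, ∫ ξ, (𝐞 (-⟪ξ, z + a • t⟫) • θ ξ) * Ψ t := by
        simp_rw [integral_mul_const, fourier_apply_eq_integral]
    _ = ∫ ξ, ∫ t, (𝐞 (-⟪ξ, z + a • t⟫) • θ ξ) * Ψ t := integral_integral_swap hint
    _ = _ := by
        refine integral_congr_ae (.of_forall fun ξ => ?_)
        simp only
        rw [fourier_apply_eq_integral, ← integral_const_mul, Circle.smul_def,
          ← integral_smul]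
        refine integral_congr_ae (.of_forall fun t => ?_)
        simp only [Circle.smul_def, smul_eq_mul]
        rw [inner_add_right, inner_smul_right, inner_smul_right, neg_add, AddChar.map_add_eq_mul,
          real_inner_comm ξ t, Circle.coe_mul]
        ring

/-- A tame function which annihilates all band-limited Schwartz functions annihilates all Schwartz
functions. -/
theorem Tame.integral_mul_eq_zero {h : V → ℂ} (hh : Tame h)
    (h0 : ∀ θ : 𝓢(V, ℂ), HasCompactSupport θ → ∫ z, 𝓕 θ z * h z = 0) (φ : 𝓢(V, ℂ)) :
    ∫ z, φ z * h z = 0 := by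
  let b : ContDiffBump (0 : V) := ⟨1, 2, zero_lt_one, one_lt_two⟩
  have hb₁ : HasCompactSupport (Complex.ofRealCLM ∘ b) := b.hasCompactSupport.comp_left rfl
  have hb₂ : ContDiff ℝ ∞ (Complex.ofRealCLM ∘ b) := Complex.ofRealCLM.contDiff.comp b.contDiff
  set ψ : 𝓢(V, ℂ) := hb₁.toSchwartzMap hb₂ with hψ
  have hψ0 : ψ 0 = 1 := by
    have : b 0 = 1 := b.one_of_mem_closedBall (by simp [b])
    simp [hψ, this]
  have hψc : HasCompactSupport ψ := hb₁
  set Ψ := 𝓕⁻ ψ with hΨ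
  set θ := 𝓕⁻ φ with hθ
  have hφ : φ = 𝓕 θ := by rw [hθ, FourierInvPair.fourier_fourierInv_eq]
  have hψΨ : ψ = 𝓕 Ψ := by rw [hΨ, FourierInvPair.fourier_fourierInv_eq]
  obtain ⟨C, hC0, hC⟩ := exists_norm_le_weight φ
  obtain ⟨B, hB0, hB⟩ := exists_norm_le_weight_pow Ψ 2
  let a : ℕ → ℝ := fun j => 1 / ((j : ℝ) + 1)
  have ha0 : ∀ j, 0 < a j := fun j => by positivity
  have ha1 : ∀ j, a j ≤ 1 := fun j => by
    simp only [a]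
    rw [div_le_one (by positivity)]
    linarith [(Nat.cast_nonneg j : (0 : ℝ) ≤ j)]
  have ha : Filter.Tendsto a Filter.atTop (nhds 0) := tendsto_one_div_add_atTop_nhds_zero_nat
  -- These averages tend to `φ` because `∫ Ψ = ψ 0 = 1`, and they are band-limited because their
  -- frequency side is `θ · ψ (a j • ·)`. The bound by `weight`, uniform in `j` since `a j ≤ 1`,
  -- allows dominated convergence against `h`.
  let Φ : ℕ → V → ℂ := fun j z => ∫ t, φ (z + a j • t) * Ψ t
  have hΦbound : ∀ j z, ‖Φ j z‖ ≤ (C * B * ∫ t : V, weight t) * weight z := by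
    intro j z
    calc ‖Φ j z‖ ≤ ∫ t, (C * B * weight z) * weight t := by
          refine norm_integral_le_of_norm_le (integrable_weight.const_mul _)
            (.of_forall fun t => ?_)
          have h1 : weight (z + a j • t) ≤ (weight t)⁻¹ * weight z := by
            have h2 := weight_sub_le (-(a j • t)) z
            rw [weight_sub_comm, sub_neg_eq_add, weight_neg] at h2
            refine h2.trans ?_
            gcongr ?_ * _
            · exact (weight_pos z).le
            · simp only [weight, inv_inv]
              gcongr
              rw [norm_smul, Real.norm_of_nonneg (ha0 j).le]
              exact mul_le_of_le_one_left (norm_nonneg _) (ha1 j)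
          rw [norm_mul]
          calc _ ≤ (C * ((weight t)⁻¹ * weight z)) * (B * weight t ^ 2) := by
                refine mul_le_mul ((hC _).trans (by gcongr)) (hB t) (norm_nonneg _) ?_
                have := weight_pos t
                have := weight_pos z
                positivity
            _ = _ := by
                have := (weight_pos t).ne'
                field_simp
      _ = _ := by rw [integral_const_mul]; ring
  have hΦlim : ∀ z, Filter.Tendsto (fun j => Φ j z) Filter.atTop (nhds (φ z)) := by
    intro z
    have hval : φ z = ∫ t, φ z * Ψ t := by
      have : ∫ t, Ψ t = ψ 0 := by
        rw [hψΨ, fourier_apply_eq_integral]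
        simp
      rw [integral_const_mul, this, hψ0, mul_one]
    rw [hval]
    refine tendsto_integral_of_dominated_convergence (fun t => C * ‖Ψ t‖) (fun j => ?_)
      (Ψ.integrable.norm.const_mul C) (fun j => .of_forall fun t => ?_) (.of_forall fun t => ?_)
    · exact ((φ.continuous.comp (by fun_prop)).mul Ψ.continuous).aestronglyMeasurable
    · rw [norm_mul]
      gcongr
      exact (hC _).trans (mul_le_of_le_one_right hC0 (weight_le_one _))
    · refine Filter.Tendsto.mul_const _ ?_
      refine (φ.continuous.tendsto z).comp ?_
      simpa using (tendsto_const_nhds (x := z)).add (ha.smul_const t)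
  have hΦzero : ∀ j, ∫ z, Φ j z * h z = 0 := by
    intro j
    have hdc : HasCompactSupport fun ξ => ψ (a j • ξ) :=
      hψc.comp_homeomorph (Homeomorph.smulOfNeZero (a j) (ha0 j).ne')
    have hc₁ : HasCompactSupport fun ξ => θ ξ * ψ (a j • ξ) := hdc.mul_left
    have hc₂ : ContDiff ℝ ∞ fun ξ => θ ξ * ψ (a j • ξ) :=
      (θ.smooth ⊤).mul ((ψ.smooth ⊤).comp (contDiff_const_smul _))
    have := h0 (hc₁.toSchwartzMap hc₂) hc₁
    rw [← this]
    refine integral_congr_ae (.of_forall fun z => ?_)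
    simp only [Φ]
    congr 1
    rw [hφ, integral_fourier_dilate_mul, fourier_apply_eq_integral, ← hψΨ]
    rfl
  have hlim : Filter.Tendsto (fun j => ∫ z, Φ j z * h z) Filter.atTop (nhds (∫ z, φ z * h z)) := by
    set D := C * B * ∫ t : V, weight t
    refine tendsto_integral_of_dominated_convergence (fun z => D * ‖(weight z : ℂ) * h z‖)
      (fun j => ?_) (hh.norm.const_mul _) (fun j => .of_forall fun z => ?_)
      (.of_forall fun z => (hΦlim z).mul_const _)
    · refine AEStronglyMeasurable.mul ?_ hh.aestronglyMeasurable
      have : AEStronglyMeasurable (fun p : V × V => φ (p.1 + a j • p.2) * Ψ p.2)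
          (volume.prod volume) :=
        ((φ.continuous.comp (by fun_prop)).mul
          (Ψ.continuous.comp continuous_snd)).aestronglyMeasurable
      exact this.integral_prod_right'
    · rw [norm_mul, norm_mul, Complex.norm_real, Real.norm_of_nonneg (weight_pos z).le, ← mul_assoc]
      gcongr
      exact hΦbound j z
  simp_rw [hΦzero] at hlim
  exact (tendsto_nhds_unique hlim tendsto_const_nhds)

/-- A locally integrable function which annihilates all Schwartz functions vanishes. -/
theorem ae_eq_zero_of_integral_schwartz {h : V → ℂ} (hl : LocallyIntegrable h)
    (h0 : ∀ φ : 𝓢(V, ℂ), ∫ z, φ z * h z = 0) : h =ᵐ[volume] 0 := by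
  refine ae_eq_zero_of_integral_contDiff_smul_eq_zero hl fun g hg hgc => ?_
  have hg₁ : HasCompactSupport (Complex.ofRealCLM ∘ g) := hgc.comp_left rfl
  have hg₂ : ContDiff ℝ ∞ (Complex.ofRealCLM ∘ g) := by fun_prop
  simpa using h0 (hg₁.toSchwartzMap hg₂)

end FourierIdentities

/-! ### The partition of unity, its symbols and its kernels. -/

section Window

open FourierTransform

variable {n : ℕ} {ρ : EuclideanSpace ℝ (Fin n) → ℝ}

@[simp]
theorem latticePoint_apply (k : Fin n → ℤ) (i : Fin n) : latticePoint k i = k i := rfl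

theorem latticePoint_add (k l : Fin n → ℤ) :
    latticePoint (k + l) = latticePoint k + latticePoint l := by
  ext i
  simp

@[simp]
theorem latticePoint_zero : latticePoint (0 : Fin n → ℤ) = 0 := by
  ext i
  simp

theorem IsWindow.abs_le_one_of_ne_zero (hρ : IsWindow ρ) {ξ : EuclideanSpace ℝ (Fin n)}
    (h : ρ ξ ≠ 0) (i : Fin n) : |ξ i| ≤ 1 :=
  abs_le.2 (hρ.support_subset (subset_tsupport ρ h) i)

theorem IsWindow.hasCompactSupport (hρ : IsWindow ρ) : HasCompactSupport ρ := by
  have hc : IsCompact {ξ : EuclideanSpace ℝ (Fin n) | ∀ i, -1 ≤ ξ i ∧ ξ i ≤ 1} := by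
    have := (EuclideanSpace.equiv (Fin n) ℝ).toHomeomorph.isCompact_preimage.2
      (isCompact_Icc (a := fun _ : Fin n => (-1 : ℝ)) (b := fun _ => 1))
    convert this using 1
    ext ξ
    simp [Pi.le_def, forall_and]
  exact hc.of_isClosed_subset (isClosed_tsupport ρ) hρ.support_subset

/-- A finite box containing the lattice points in the cube of radius `r` around `ξ`. -/
noncomputable def nearLattice (r : ℤ) (ξ : EuclideanSpace ℝ (Fin n)) : Finset (Fin n → ℤ) :=
  Fintype.piFinset fun i => Finset.Icc (⌊ξ i⌋ - r) (⌊ξ i⌋ + r + 1)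

theorem mem_nearLattice {r : ℤ} {ξ : EuclideanSpace ℝ (Fin n)} {k : Fin n → ℤ}
    (h : ∀ i, |ξ i - k i| ≤ r) : k ∈ nearLattice r ξ := by
  simp only [nearLattice, Fintype.mem_piFinset, Finset.mem_Icc]
  intro i
  have h1 := abs_le.1 (h i)
  have h2 := Int.floor_le (ξ i)
  have h3 := Int.lt_floor_add_one (ξ i)
  constructor
  · have : (⌊ξ i⌋ : ℝ) - r ≤ k i := by linarith
    exact_mod_cast this
  · have : (k i : ℝ) ≤ ⌊ξ i⌋ + r + 1 := by linarith
    exact_mod_cast this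

theorem IsWindow.mem_nearLattice_of_ne_zero (hρ : IsWindow ρ) {ξ η : EuclideanSpace ℝ (Fin n)}
    {r : ℤ} (hη : ∀ i, |ξ i - η i| ≤ r) {k : Fin n → ℤ} (h : ρ (η - latticePoint k) ≠ 0) :
    k ∈ nearLattice (r + 1) ξ := by
  refine mem_nearLattice fun i => ?_
  have h1 := hρ.abs_le_one_of_ne_zero h i
  simp only [PiLp.sub_apply, latticePoint_apply] at h1
  push_cast
  calc |ξ i - k i| = |(ξ i - η i) + (η i - k i)| := by ring_nf
    _ ≤ r + 1 := (abs_add_le _ _).trans (add_le_add (hη i) h1)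

theorem IsWindow.tsum_eq_sum (hρ : IsWindow ρ) {ξ η : EuclideanSpace ℝ (Fin n)} {r : ℤ}
    (hη : ∀ i, |ξ i - η i| ≤ r) :
    ∑' j, ρ (η - latticePoint j) = ∑ j ∈ nearLattice (r + 1) ξ, ρ (η - latticePoint j) :=
  _root_.tsum_eq_sum fun _ hj => by_contra fun h => hj (hρ.mem_nearLattice_of_ne_zero hη h)

theorem IsWindow.summable (hρ : IsWindow ρ) (ξ : EuclideanSpace ℝ (Fin n)) :
    Summable fun j : Fin n → ℤ => ρ (ξ - latticePoint j) :=
  summable_of_ne_finset_zero (s := nearLattice (0 + 1) ξ) fun _ hj =>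
    by_contra fun h => hj (hρ.mem_nearLattice_of_ne_zero (by simp) h)

theorem IsWindow.one_le_tsum (hρ : IsWindow ρ) (ξ : EuclideanSpace ℝ (Fin n)) :
    1 ≤ ∑' j : Fin n → ℤ, ρ (ξ - latticePoint j) := by
  -- Rounding each coordinate leaves a remainder in the cube where `ρ = 1`.
  have h : ρ (ξ - latticePoint fun i => round (ξ i)) = 1 :=
    hρ.eq_one _ fun i => by simpa using abs_sub_round (ξ i)
  rw [← h]
  exact (hρ.summable ξ).le_tsum _ fun j _ => hρ.nonneg _

theorem IsWindow.contDiff_tsum (hρ : IsWindow ρ) :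
    ContDiff ℝ ∞ fun ξ => ∑' j : Fin n → ℤ, ρ (ξ - latticePoint j) := by
  rw [contDiff_iff_contDiffAt]
  intro ξ
  have hs : ContDiffAt ℝ ∞
      (fun η => ∑ j ∈ nearLattice (1 + 1) ξ, ρ (η - latticePoint j)) ξ :=
    ContDiffAt.sum fun j _ => (hρ.smooth.comp (by fun_prop)).contDiffAt
  refine hs.congr_of_eventuallyEq ?_
  filter_upwards [Metric.ball_mem_nhds ξ one_pos] with η hη
  refine hρ.tsum_eq_sum fun i => ?_
  rw [Metric.mem_ball, dist_comm, dist_eq_norm] at hη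
  have := PiLp.norm_apply_le (ξ - η) i
  simp only [PiLp.sub_apply, Real.norm_eq_abs] at this
  push_cast
  linarith

theorem IsWindow.contDiff_sigma (hρ : IsWindow ρ) (k : Fin n → ℤ) : ContDiff ℝ ∞ (sigma ρ k) :=
  (hρ.smooth.comp (by fun_prop)).div hρ.contDiff_tsum fun ξ =>
    (zero_lt_one.trans_le (hρ.one_le_tsum ξ)).ne'

theorem IsWindow.hasCompactSupport_sigma (hρ : IsWindow ρ) (k : Fin n → ℤ) :
    HasCompactSupport (sigma ρ k) := by
  have h1 : HasCompactSupport fun ξ => ρ (ξ - latticePoint k) :=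
    hρ.hasCompactSupport.comp_homeomorph (Homeomorph.subRight (latticePoint k))
  unfold sigma
  simp_rw [div_eq_mul_inv]
  exact h1.mul_right

theorem IsWindow.abs_le_of_sigma_ne_zero (hρ : IsWindow ρ) {k : Fin n → ℤ}
    {ξ : EuclideanSpace ℝ (Fin n)} (h : sigma ρ k ξ ≠ 0) (i : Fin n) : |ξ i - k i| ≤ 1 := by
  have : ρ (ξ - latticePoint k) ≠ 0 := fun h0 => h (by simp [sigma, h0])
  simpa using hρ.abs_le_one_of_ne_zero this i

/-- The denominator is periodic under the lattice. -/
theorem sigma_eq_sigma_zero (ρ : EuclideanSpace ℝ (Fin n) → ℝ) (k : Fin n → ℤ)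
    (ξ : EuclideanSpace ℝ (Fin n)) : sigma ρ k ξ = sigma ρ 0 (ξ - latticePoint k) := by
  rw [sigma, sigma, latticePoint_zero, sub_zero,
    ← (Equiv.addLeft k).tsum_eq fun j => ρ (ξ - latticePoint j)]
  simp [latticePoint_add, sub_sub]

theorem IsWindow.sum_sigma_eq_one (hρ : IsWindow ρ) {ξ : EuclideanSpace ℝ (Fin n)}
    {F : Finset (Fin n → ℤ)} (hF : ∀ k, sigma ρ k ξ ≠ 0 → k ∈ F) :
    ∑ k ∈ F, sigma ρ k ξ = 1 := by
  have hpos := (zero_lt_one.trans_le (hρ.one_le_tsum ξ)).ne'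
  simp only [sigma]
  rw [← Finset.sum_div, div_eq_one_iff_eq hpos, eq_comm]
  refine _root_.tsum_eq_sum fun k hk => by_contra fun h => hk (hF k ?_)
  exact div_ne_zero h hpos

/-- The symbol of `□_k` in Mathlib's frequency variable. -/
noncomputable def symbol (hρ : IsWindow ρ) (k : Fin n → ℤ) : 𝓢(EuclideanSpace ℝ (Fin n), ℂ) :=
  HasCompactSupport.toSchwartzMap (f := fun ξ => ((sigma ρ k ((2 * Real.pi) • ξ) : ℝ) : ℂ))
    (((hρ.hasCompactSupport_sigma k).comp_homeomorph
      (Homeomorph.smulOfNeZero (2 * Real.pi) (by positivity))).comp_left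
        (g := Complex.ofReal) Complex.ofReal_zero)
    (Complex.ofRealCLM.contDiff.comp ((hρ.contDiff_sigma k).comp (contDiff_const_smul _)))

theorem symbol_apply (hρ : IsWindow ρ) (k : Fin n → ℤ) (ξ : EuclideanSpace ℝ (Fin n)) :
    symbol hρ k ξ = ((sigma ρ k ((2 * Real.pi) • ξ) : ℝ) : ℂ) := rfl

/-- A symbol equal to `1` on the support of the symbol of `□_k`. -/
noncomputable def wideSymbol (hρ : IsWindow ρ) (k : Fin n → ℤ) :
    𝓢(EuclideanSpace ℝ (Fin n), ℂ) :=
  HasCompactSupport.toSchwartzMap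
    (f := fun ξ => ((ρ ((2 : ℝ)⁻¹ • ((2 * Real.pi) • ξ - latticePoint k)) : ℝ) : ℂ))
    ((hρ.hasCompactSupport.comp_homeomorph
      (((Homeomorph.smulOfNeZero (2 * Real.pi) (by positivity)).trans
        (Homeomorph.subRight (latticePoint k))).trans
          (Homeomorph.smulOfNeZero (2 : ℝ)⁻¹ (by positivity)))).comp_left
            (g := Complex.ofReal) Complex.ofReal_zero)
    (Complex.ofRealCLM.contDiff.comp (hρ.smooth.comp (by fun_prop)))

theorem wideSymbol_apply (hρ : IsWindow ρ) (k : Fin n → ℤ) (ξ : EuclideanSpace ℝ (Fin n)) :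
    wideSymbol hρ k ξ = ((ρ ((2 : ℝ)⁻¹ • ((2 * Real.pi) • ξ - latticePoint k)) : ℝ) : ℂ) := rfl

/-- Where `sigma ρ k` is non-zero, `|ξ_i - k_i| ≤ 1`; the factor `1/2` moves this into the cube
where `ρ = 1`. -/
theorem wideSymbol_mul_symbol (hρ : IsWindow ρ) (k : Fin n → ℤ) (ξ : EuclideanSpace ℝ (Fin n)) :
    wideSymbol hρ k ξ * symbol hρ k ξ = symbol hρ k ξ := by
  rw [symbol_apply, wideSymbol_apply]
  by_cases h : sigma ρ k ((2 * Real.pi) • ξ) = 0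
  · simp [h]
  · rw [hρ.eq_one, Complex.ofReal_one, one_mul]
    intro i
    have := hρ.abs_le_of_sigma_ne_zero h i
    simp only [PiLp.smul_apply, PiLp.sub_apply, latticePoint_apply, smul_eq_mul, abs_mul] at this ⊢
    rw [abs_of_pos (by norm_num : (0 : ℝ) < 2⁻¹)]
    linarith

/-- The convolution kernel of `□_k`. -/
noncomputable def kernel (hρ : IsWindow ρ) (k : Fin n → ℤ) : 𝓢(EuclideanSpace ℝ (Fin n), ℂ) :=
  𝓕⁻ (symbol hρ k)

/-- A convolution kernel reproducing the functions in the range of `□_k`. -/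
noncomputable def wideKernel (hρ : IsWindow ρ) (k : Fin n → ℤ) :
    𝓢(EuclideanSpace ℝ (Fin n), ℂ) :=
  𝓕⁻ (wideSymbol hρ k)

theorem norm_kernel (hρ : IsWindow ρ) (k : Fin n → ℤ) (x : EuclideanSpace ℝ (Fin n)) :
    ‖kernel hρ k x‖ = ‖kernel hρ 0 x‖ := by
  refine norm_fourierInv_eq_of_translate (a := (2 * Real.pi)⁻¹ • latticePoint k) (fun ξ => ?_) x
  rw [symbol_apply, symbol_apply, sigma_eq_sigma_zero, smul_sub,
    smul_inv_smul₀ (by positivity)]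

theorem norm_wideKernel (hρ : IsWindow ρ) (k : Fin n → ℤ) (x : EuclideanSpace ℝ (Fin n)) :
    ‖wideKernel hρ k x‖ = ‖wideKernel hρ 0 x‖ := by
  refine norm_fourierInv_eq_of_translate (a := (2 * Real.pi)⁻¹ • latticePoint k) (fun ξ => ?_) x
  rw [wideSymbol_apply, wideSymbol_apply, smul_sub (2 * Real.pi), smul_inv_smul₀ (by positivity),
    latticePoint_zero, sub_zero]

theorem exists_norm_kernel_le (hρ : IsWindow ρ) (m : ℕ) :
    ∃ C : ℝ, 0 ≤ C ∧ ∀ k x, ‖kernel hρ k x‖ ≤ C * weight x ^ m := by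
  obtain ⟨C, hC, h⟩ := exists_norm_le_weight_pow (kernel hρ 0) m
  exact ⟨C, hC, fun k x => (norm_kernel hρ k x).trans_le (h x)⟩

theorem exists_norm_wideKernel_le (hρ : IsWindow ρ) (m : ℕ) :
    ∃ C : ℝ, 0 ≤ C ∧ ∀ k x, ‖wideKernel hρ k x‖ ≤ C * weight x ^ m := by
  obtain ⟨C, hC, h⟩ := exists_norm_le_weight_pow (wideKernel hρ 0) m
  exact ⟨C, hC, fun k x => (norm_wideKernel hρ k x).trans_le (h x)⟩

theorem integral_wideKernel_mul_kernel (hρ : IsWindow ρ) (k : Fin n → ℤ)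
    (x z : EuclideanSpace ℝ (Fin n)) :
    ∫ y, wideKernel hρ k (x - y) * kernel hρ k (y - z) = kernel hρ k (x - z) :=
  integral_fourierInv_sub_mul_fourierInv_sub (wideSymbol_mul_symbol hρ k) x z

/-- Each symbol fixes its frequency up to `1` in every coordinate, and the frequencies satisfy `t =
(t - η) + η`; the three errors add up to `3`. -/
theorem integral_kernel_mul_kernel_mul_kernel_eq_zero (hρ : IsWindow ρ) {m k l : Fin n → ℤ}
    (h : ¬ ∀ i, |m i - k i - l i| ≤ 3) (x z w : EuclideanSpace ℝ (Fin n)) :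
    ∫ y, kernel hρ m (x - y) * kernel hρ k (y - z) * kernel hρ l (y - w) = 0 := by
  refine integral_fourierInv_mul_mul_eq_zero (fun t η => ?_) x z w
  simp only [symbol_apply]
  by_contra hne
  refine h fun i => ?_
  have h12 := left_ne_zero_of_mul hne
  have h1 := hρ.abs_le_of_sigma_ne_zero (Complex.ofReal_ne_zero.1 (left_ne_zero_of_mul h12)) i
  have h2 := hρ.abs_le_of_sigma_ne_zero (Complex.ofReal_ne_zero.1 (right_ne_zero_of_mul h12)) i
  have h3 := hρ.abs_le_of_sigma_ne_zero (Complex.ofReal_ne_zero.1 (right_ne_zero_of_mul hne)) i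
  simp only [PiLp.smul_apply, PiLp.sub_apply, smul_eq_mul] at h1 h2 h3
  have : |(m i : ℝ) - k i - l i| ≤ 3 := by
    rw [abs_le] at *
    constructor <;> linarith [h1.1, h1.2, h2.1, h2.2, h3.1, h3.2]
  exact_mod_cast this

end Window

/-! ### From distributions to functions. -/

section Representation

open FourierTransform Real

variable {n : ℕ} {ρ : EuclideanSpace ℝ (Fin n) → ℝ}
  {f h : EuclideanSpace ℝ (Fin n) → ℂ} {u v : 𝓢'(EuclideanSpace ℝ (Fin n), ℂ)}

/-- Fubini moves the kernel onto the test function, where `integral_mul_fourierInv_sub` recognises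
the multiplier. -/
theorem Represents.conv (hρ : IsWindow ρ) (hu : Represents f u) (hf : Tame f)
    (k : Fin n → ℤ) : Represents (conv (kernel hρ k) f) (box ρ k u) := by
  intro φ
  obtain ⟨C, hC0, hC⟩ := exists_norm_le_weight_pow φ 2
  obtain ⟨B, hB0, hB⟩ := hf.exists_norm_conv_le (kernel hρ k)
  constructor
  · refine (integrable_weight.const_mul (C * B)).mono'
      (φ.continuous.aestronglyMeasurable.mul
        (aestronglyMeasurable_conv (kernel hρ k).continuous hf.aestronglyMeasurable))
      (.of_forall fun x => ?_)
    rw [norm_mul]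
    have hw := weight_pos x
    calc _ ≤ (C * weight x ^ 2) * (B * (weight x)⁻¹) :=
          mul_le_mul (hC x) (hB x) (norm_nonneg _) (by positivity)
      _ = _ := by field_simp
  · rw [hf.integral_mul_conv (kernel hρ k) φ.continuous.aestronglyMeasurable hC, box,
      TemperedDistribution.fourierMultiplierCLM_apply_apply, (hu _).2]
    refine integral_congr_ae (.of_forall fun z => ?_)
    simp only [kernel]
    rw [integral_mul_fourierInv_sub, fourier_apply_eq_integral]
    congr 1
    refine integral_congr_ae (.of_forall fun ξ => ?_)
    simp only
    have := SchwartzMap.smulLeftCLM_apply_apply (symbol hρ k).hasTemperateGrowth (𝓕⁻ φ) ξ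
    exact congrArg (fun c : ℂ => 𝐞 (-inner ℝ ξ z) • c) this

theorem Represents.dist_eq (hu : Represents f u) (hv : Represents f v) : u = v := by
  ext φ
  rw [(hu φ).2, (hv φ).2]

theorem Represents.locallyIntegrable (hu : Represents f u) : LocallyIntegrable f := by
  intro x
  let b : ContDiffBump x := ⟨1, 2, zero_lt_one, one_lt_two⟩
  have hb₁ : HasCompactSupport (Complex.ofRealCLM ∘ b) := b.hasCompactSupport.comp_left rfl
  have hb₂ : ContDiff ℝ ∞ (Complex.ofRealCLM ∘ b) := Complex.ofRealCLM.contDiff.comp b.contDiff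
  refine ⟨Metric.closedBall x 1, Metric.closedBall_mem_nhds x one_pos, ?_⟩
  refine (hu (hb₁.toSchwartzMap hb₂)).1.integrableOn.congr_fun (fun y hy => ?_)
    Metric.isClosed_closedBall.measurableSet
  have : b y = 1 := b.one_of_mem_closedBall hy
  simp [this]

theorem Represents.ae_eq (hu : Represents f u) (hv : Represents h u) : f =ᵐ[volume] h := by
  have := ae_eq_zero_of_integral_schwartz (hu.locallyIntegrable.sub hv.locallyIntegrable)
    fun φ => by
      simp only [Pi.sub_apply, mul_sub]
      rw [integral_sub (hu φ).1 (hv φ).1, ← (hu φ).2, ← (hv φ).2, sub_self]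
  filter_upwards [this] with x hx
  exact sub_eq_zero.1 hx

theorem Represents.distLpNorm_eq (hu : Represents f u) (p : ℝ≥0∞) :
    distLpNorm p u = eLpNorm f p volume :=
  le_antisymm (iInf₂_le f hu)
    (le_iInf₂ fun _ hg => (eLpNorm_congr_ae (hu.ae_eq hg)).le)

/-- The distribution is unique, and so are the functions representing its pieces up to null sets.
Both infima therefore disappear and the norm becomes explicit. -/
theorem Represents.gevreyNorm_eq (hρ : IsWindow ρ) (hu : Represents f u) (hf : Tame f) (s : ℝ)
    (p q : ℝ≥0∞) : gevreyNorm ρ s p q f =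
      seqNorm q fun k : Fin n → ℤ => ENNReal.ofReal (Real.exp (‖latticePoint k‖ ^ (1 / s))) *
        eLpNorm (GevreyModulation.conv (kernel hρ k) f) p volume := by
  have h1 : gevreyNorm ρ s p q f = distGevreyNorm ρ s p q u :=
    le_antisymm (iInf₂_le u hu) (le_iInf₂ fun v hv => by rw [hu.dist_eq hv])
  rw [h1, distGevreyNorm]
  congr 1
  ext k
  rw [(hu.conv hρ hf k).distLpNorm_eq]

theorem exists_represents_of_memLp {p : ℝ≥0∞} (hp : 1 ≤ p) (hf : MemLp f p volume) :
    ∃ u, Represents f u := by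
  have : Fact (1 ≤ p) := ⟨hp⟩
  refine ⟨Lp.toTemperedDistribution (hf.toLp f), fun φ => ⟨?_, ?_⟩⟩
  · obtain ⟨C, _, hC⟩ := exists_norm_le_weight φ
    exact (Tame.of_memLp hp hf).integrable_mul φ.continuous.aestronglyMeasurable hC
  · rw [Lp.toTemperedDistribution_apply]
    refine integral_congr_ae ?_
    filter_upwards [hf.coeFn_toLp] with x hx
    rw [hx, smul_eq_mul]

end Representation

/-! ### Weighted averages of a function. -/

section Smear

variable {V : Type*} [NormedAddCommGroup V] [InnerProductSpace ℝ V] [FiniteDimensional ℝ V]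
  [MeasurableSpace V] [BorelSpace V]

/-- The convolution of `|h|` with the polynomial weight. -/
noncomputable def smear (h : V → ℂ) (x : V) : ℝ≥0∞ :=
  ∫⁻ y, ENNReal.ofReal (weight (x - y)) * ‖h y‖ₑ

/-- The total mass of the polynomial weight. -/
noncomputable def weightMass (V : Type*) [NormedAddCommGroup V] [InnerProductSpace ℝ V]
    [FiniteDimensional ℝ V] [MeasurableSpace V] [BorelSpace V] : ℝ≥0∞ :=
  ∫⁻ y : V, ENNReal.ofReal (weight y)

theorem weightMass_ne_top : weightMass V ≠ ⊤ := by
  rw [weightMass, ← ofReal_integral_eq_lintegral_ofReal integrable_weight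
    (.of_forall fun x => (weight_pos x).le)]
  exact ENNReal.ofReal_ne_top

theorem lintegral_weight_sub_left (x : V) :
    ∫⁻ y, ENNReal.ofReal (weight (x - y)) = weightMass V :=
  lintegral_sub_left_eq_self (fun y => ENNReal.ofReal (weight y)) x

theorem lintegral_weight_sub_right (y : V) :
    ∫⁻ x, ENNReal.ofReal (weight (x - y)) = weightMass V :=
  lintegral_sub_right_eq_self (fun y => ENNReal.ofReal (weight y)) y

theorem measurable_weight_sub :
    Measurable (Function.uncurry fun x y : V => ENNReal.ofReal (weight (x - y))) := by
  have : Continuous (Function.uncurry fun x y : V => weight (x - y)) := by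
    simp only [Function.uncurry_def]
    fun_prop
  exact this.measurable.ennreal_ofReal

theorem aemeasurable_smear {h : V → ℂ} (hh : AEStronglyMeasurable h) : AEMeasurable (smear h) := by
  have : AEMeasurable
      (Function.uncurry fun x y : V => ENNReal.ofReal (weight (x - y)) * ‖h y‖ₑ)
      (volume.prod volume) :=
    measurable_weight_sub.aemeasurable.mul hh.enorm.comp_snd
  exact this.lintegral_prod_right'

/-- Schur's test; the constant does not depend on `p`. -/
theorem eLpNorm_smear_le {h : V → ℂ} (hh : AEStronglyMeasurable h) {p : ℝ≥0∞} (hp : 1 ≤ p) :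
    eLpNorm (smear h) p volume ≤ weightMass V * eLpNorm h p volume := by
  rw [← eLpNorm_enorm h]
  exact eLpNorm_lintegral_kernel_le measurable_weight_sub hh.enorm
    (fun x => (lintegral_weight_sub_left x).le) (fun y => (lintegral_weight_sub_right y).le) hp

/-- Hölder against a translated weight. Here `D` may depend on `p`; it serves only to prove
convergence and does not enter the final constant. -/
theorem exists_smear_le (p : ℝ≥0∞) (hp : 1 ≤ p) :
    ∃ D : ℝ≥0∞, D ≠ ⊤ ∧ ∀ h : V → ℂ, AEStronglyMeasurable h →
      ∀ x, smear h x ≤ D * eLpNorm h p volume := by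
  have := ENNReal.HolderConjugate.inv_one_sub_inv' hp
  have hw : ∀ x : V, ‖(weight x : ℂ)‖ₑ = ENNReal.ofReal (weight x) := fun x => by
    rw [← ofReal_norm, Complex.norm_real, Real.norm_of_nonneg (weight_pos x).le]
  have hm := memLp_weight (V := V) (1 - p⁻¹)⁻¹ (by simp)
  refine ⟨_, hm.eLpNorm_lt_top.ne, fun h hh x => ?_⟩
  have h1 := eLpNorm_mul_le_ennreal (μ := (volume : Measure V)) (r := 1) (p := (1 - p⁻¹)⁻¹) (q := p)
    (f := fun y => ENNReal.ofReal (weight (x - y))) (g := fun y => ‖h y‖ₑ)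
    (measurable_weight_sub.comp measurable_prodMk_left).aemeasurable hh.enorm (by simp) hp (by
      have := ENNReal.HolderTriple.inv_add_inv_eq_inv p (1 - p⁻¹)⁻¹ 1
      rw [← this, add_comm])
  rw [eLpNorm_one_eq_lintegral_enorm, eLpNorm_enorm h] at h1
  simp only [enorm_eq_self] at h1
  refine h1.trans_eq ?_
  congr 1
  have h2 := eLpNorm_comp_measurePreserving (p := (1 - p⁻¹)⁻¹) hm.1
    (Measure.measurePreserving_sub_left (volume : Measure V) x)
  rw [← h2, ← eLpNorm_enorm (_ ∘ _)]
  simp only [Function.comp_apply, hw]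

end Smear

/-! ### The pieces `□_k f` and the reconstruction of `f`. -/

section Pieces

open FourierTransform

variable {n : ℕ} {ρ : EuclideanSpace ℝ (Fin n) → ℝ} {f g : EuclideanSpace ℝ (Fin n) → ℂ}

theorem Tame.conv_wideKernel (hρ : IsWindow ρ) (hf : Tame f) (k : Fin n → ℤ)
    (x : EuclideanSpace ℝ (Fin n)) :
    conv (wideKernel hρ k) (conv (kernel hρ k) f) x = conv (kernel hρ k) f x := by
  obtain ⟨C, hC0, hC⟩ := exists_norm_wideKernel_le hρ 2
  rw [conv, hf.integral_mul_conv (kernel hρ k) (S := fun y => wideKernel hρ k (x - y))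
    (C := C * (weight x)⁻¹ ^ 2)
    ((wideKernel hρ k).continuous.comp (by fun_prop)).aestronglyMeasurable]
  · simp_rw [integral_wideKernel_mul_kernel]
    rfl
  · intro y
    refine (hC k _).trans ?_
    rw [mul_assoc, ← mul_pow]
    have := weight_pos (x - y)
    gcongr
    exact weight_sub_le x y

/-- A uniform pointwise bound for the pieces `□_k f` in terms of local averages. -/
theorem exists_enorm_conv_le_smear (hρ : IsWindow ρ) :
    ∃ C : ℝ, 0 ≤ C ∧ ∀ f : EuclideanSpace ℝ (Fin n) → ℂ, Tame f → ∀ k x y,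
      ‖conv (kernel hρ k) f y‖ₑ ≤
        ENNReal.ofReal (C * (weight (x - y))⁻¹) * smear (conv (kernel hρ k) f) x := by
  obtain ⟨C, hC0, hC⟩ := exists_norm_wideKernel_le hρ 1
  refine ⟨C, hC0, fun f hf k x y => ?_⟩
  calc ‖conv (kernel hρ k) f y‖ₑ
      = ‖conv (wideKernel hρ k) (conv (kernel hρ k) f) y‖ₑ := by rw [hf.conv_wideKernel]
    _ ≤ ∫⁻ z, ‖wideKernel hρ k (y - z) * conv (kernel hρ k) f z‖ₑ :=
        enorm_integral_le_lintegral_enorm _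
    _ ≤ ∫⁻ z, ENNReal.ofReal (C * (weight (x - y))⁻¹) *
          (ENNReal.ofReal (weight (x - z)) * ‖conv (kernel hρ k) f z‖ₑ) := by
        gcongr with z
        rw [enorm_mul, ← mul_assoc]
        have hw := weight_pos (x - y)
        rw [← ENNReal.ofReal_mul (by positivity)]
        gcongr
        rw [← ofReal_norm]
        refine ENNReal.ofReal_le_ofReal ((hC k _).trans ?_)
        rw [pow_one, mul_assoc]
        gcongr
        rw [inv_mul_eq_div, le_div_iff₀ hw]
        have := weight_mul_weight_le (y - z) (x - y)
        rwa [sub_add_sub_cancel'] at this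
    _ = _ := by
        rw [lintegral_const_mul' _ _ ENNReal.ofReal_ne_top]
        rfl

/-- A Bernstein inequality, uniform in `k`: the average at a point controls the piece at that same
point. -/
theorem exists_enorm_conv_le_eLpNorm (hρ : IsWindow ρ) (p : ℝ≥0∞) (hp : 1 ≤ p) :
    ∃ D : ℝ≥0∞, D ≠ ⊤ ∧ ∀ f : EuclideanSpace ℝ (Fin n) → ℂ, Tame f → ∀ k x,
      ‖conv (kernel hρ k) f x‖ₑ ≤ D * eLpNorm (conv (kernel hρ k) f) p volume := by
  obtain ⟨C, hC0, hC⟩ := exists_enorm_conv_le_smear hρ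
  obtain ⟨D, hD0, hD⟩ := exists_smear_le (V := EuclideanSpace ℝ (Fin n)) p hp
  refine ⟨ENNReal.ofReal C * D, ENNReal.mul_ne_top ENNReal.ofReal_ne_top hD0,
    fun f hf k x => ?_⟩
  have h := hC f hf k x x
  have h0 : weight (0 : EuclideanSpace ℝ (Fin n)) = 1 := by simp [weight]
  rw [sub_self, h0, inv_one, mul_one] at h
  rw [mul_assoc]
  exact h.trans (by
    gcongr
    exact hD _ (aestronglyMeasurable_conv (kernel hρ k).continuous hf.aestronglyMeasurable) x)

theorem memLp_top_tsum_conv (hρ : IsWindow ρ) (hf : Tame f) {b : (Fin n → ℤ) → ℝ}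
    (hb : Summable b) (hfb : ∀ k x, ‖conv (kernel hρ k) f x‖ ≤ b k) :
    MemLp (fun x => ∑' k, conv (kernel hρ k) f x) ⊤ := by
  refine memLp_top_of_bound ?_ (∑' k, b k) (.of_forall fun x => ?_)
  · have hm : ∀ k, AEMeasurable (conv (kernel hρ k) f) := fun k =>
      (aestronglyMeasurable_conv (kernel hρ k).continuous hf.aestronglyMeasurable).aemeasurable
    refine (aemeasurable_of_tendsto_metrizable_ae (u := Filter.atTop)
      (f := fun (F : Finset (Fin n → ℤ)) x => ∑ k ∈ F, conv (kernel hρ k) f x)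
      (fun F => Finset.aemeasurable_fun_sum F fun k _ => hm k)
      (.of_forall fun x => ?_)).aestronglyMeasurable
    exact (Summable.of_norm_bounded hb fun k => hfb k x).hasSum
  · exact tsum_of_norm_bounded hb.hasSum fun k => hfb k x

theorem box_fourier_apply (hρ : IsWindow ρ) (k : Fin n → ℤ)
    (u : 𝓢'(EuclideanSpace ℝ (Fin n), ℂ)) (θ : 𝓢(EuclideanSpace ℝ (Fin n), ℂ)) :
    box ρ k u (𝓕 θ) = u (𝓕 (SchwartzMap.smulLeftCLM ℂ (symbol hρ k) θ)) := by
  rw [box, TemperedDistribution.fourierMultiplierCLM_apply_apply, FourierPair.fourierInv_fourier_eq]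
  rfl

/-- The support of `θ` is bounded, so it meets only finitely many of the cubes carrying the symbols,
and there the symbols sum to `1`. -/
theorem exists_finset_sum_smulLeftCLM_symbol (hρ : IsWindow ρ)
    {θ : 𝓢(EuclideanSpace ℝ (Fin n), ℂ)} (hθ : HasCompactSupport θ) :
    ∃ F : Finset (Fin n → ℤ), (∀ k ∉ F, SchwartzMap.smulLeftCLM ℂ (symbol hρ k) θ = 0) ∧
      ∑ k ∈ F, SchwartzMap.smulLeftCLM ℂ (symbol hρ k) θ = θ := by
  obtain ⟨R, hR⟩ := hθ.isCompact.isBounded.exists_norm_le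
  obtain ⟨r, hr⟩ := exists_nat_ge (2 * Real.pi * R)
  have key : ∀ ξ, θ ξ ≠ 0 → ∀ k, sigma ρ k ((2 * Real.pi) • ξ) ≠ 0 →
      k ∈ nearLattice ((r : ℤ) + 1) (0 : EuclideanSpace ℝ (Fin n)) := by
    intro ξ hξ k hk
    refine hρ.mem_nearLattice_of_ne_zero (η := (2 * Real.pi) • ξ) (fun i => ?_)
      (fun h0 => hk (by simp [sigma, h0]))
    have h1 := hR ξ (subset_tsupport _ hξ)
    have h2 := PiLp.norm_apply_le ξ i
    rw [Real.norm_eq_abs] at h2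
    simp only [PiLp.zero_apply, PiLp.smul_apply, smul_eq_mul, zero_sub, abs_neg, abs_mul]
    rw [abs_of_pos Real.pi_pos, abs_two]
    push_cast
    refine le_trans ?_ hr
    have := Real.pi_pos
    gcongr
    exact h2.trans h1
  refine ⟨nearLattice ((r : ℤ) + 1) 0, fun k hk => ?_, ?_⟩
  · ext ξ
    rw [SchwartzMap.smulLeftCLM_apply_apply (symbol hρ k).hasTemperateGrowth, symbol_apply]
    by_cases hξ : θ ξ = 0
    · simp [hξ]
    · have : sigma ρ k ((2 * Real.pi) • ξ) = 0 := by_contra fun h => hk (key ξ hξ k h)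
      simp [this]
  · ext ξ
    rw [sum_apply]
    simp_rw [SchwartzMap.smulLeftCLM_apply_apply (symbol hρ _).hasTemperateGrowth, symbol_apply]
    rw [← Finset.sum_smul, ← Complex.ofReal_sum]
    by_cases hξ : θ ξ = 0
    · simp [hξ]
    · rw [hρ.sum_sigma_eq_one (key ξ hξ), Complex.ofReal_one, one_smul]

/-- A function is the sum of its pieces `□_k f` if their suprema are summable. -/
theorem Represents.ae_eq_tsum_conv (hρ : IsWindow ρ) {u : 𝓢'(EuclideanSpace ℝ (Fin n), ℂ)}
    (hu : Represents f u) (hf : Tame f) {b : (Fin n → ℤ) → ℝ}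
    (hb : Summable b) (hfb : ∀ k x, ‖GevreyModulation.conv (kernel hρ k) f x‖ ≤ b k) :
    f =ᵐ[volume] fun x => ∑' k, GevreyModulation.conv (kernel hρ k) f x := by
  set G := fun x => ∑' k, GevreyModulation.conv (kernel hρ k) f x with hG
  have hGt : Tame G := Tame.of_memLp le_top (memLp_top_tsum_conv hρ hf hb hfb)
  have hint : ∀ {h : EuclideanSpace ℝ (Fin n) → ℂ}, Tame h →
      ∀ φ : 𝓢(EuclideanSpace ℝ (Fin n), ℂ), Integrable fun z => φ z * h z := by
    intro h hh φ
    obtain ⟨C, _, hC⟩ := exists_norm_le_weight φ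
    exact hh.integrable_mul φ.continuous.aestronglyMeasurable hC
  -- Against `𝓕 θ` only finitely many pieces contribute, and they add up to `u (𝓕 θ)`.
  have htest : ∀ θ : 𝓢(EuclideanSpace ℝ (Fin n), ℂ), HasCompactSupport θ →
      ∫ z, 𝓕 θ z * (f z - G z) = 0 := by
    intro θ hθ
    obtain ⟨F, hF0, hF⟩ := exists_finset_sum_smulLeftCLM_symbol hρ hθ
    have hpair : ∀ k, ∫ z, 𝓕 θ z * GevreyModulation.conv (kernel hρ k) f z
        = u (𝓕 (SchwartzMap.smulLeftCLM ℂ (symbol hρ k) θ)) := fun k => by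
      rw [← box_fourier_apply, ((hu.conv hρ hf k) (𝓕 θ)).2]
    have hsum := hasSum_integral_of_summable_integral_norm (μ := volume)
      (F := fun k z => 𝓕 θ z * GevreyModulation.conv (kernel hρ k) f z)
      (fun k => ((hu.conv hρ hf k) (𝓕 θ)).1) (by
        refine Summable.of_nonneg_of_le (fun k => integral_nonneg fun z => norm_nonneg _)
          (fun k => ?_) (hb.mul_left (∫ z, ‖𝓕 θ z‖))
        rw [← integral_mul_const]
        refine integral_mono ((hu.conv hρ hf k) (𝓕 θ)).1.norm
          ((𝓕 θ).integrable.norm.mul_const _) fun z => ?_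
        simp only [norm_mul]
        gcongr
        exact hfb k z)
    have h1 : ∫ z, 𝓕 θ z * G z = ∫ z, 𝓕 θ z * f z := by
      have h2 : ∫ z, 𝓕 θ z * G z
          = ∑' k, ∫ z, 𝓕 θ z * GevreyModulation.conv (kernel hρ k) f z := by
        rw [hsum.tsum_eq]
        simp_rw [tsum_mul_left]
        rfl
      rw [h2]
      simp_rw [hpair]
      rw [tsum_eq_sum (s := F) fun k hk => by rw [hF0 k hk]; simp, ← map_sum, ← (hu (𝓕 θ)).2]
      congr 1
      have h3 := map_sum (FourierTransform.fourierCLM ℂ 𝓢(EuclideanSpace ℝ (Fin n), ℂ))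
        (fun k => SchwartzMap.smulLeftCLM ℂ (symbol hρ k) θ) F
      rw [hF] at h3
      exact h3.symm
    simp_rw [mul_sub]
    rw [integral_sub (hint hf _) (hint hGt _), h1, sub_self]
  have hlG : LocallyIntegrable G :=
    (memLp_top_tsum_conv hρ hf hb hfb).locallyIntegrable le_top
  have := ae_eq_zero_of_integral_schwartz (hu.locallyIntegrable.sub hlG)
    ((hf.sub hGt).integral_mul_eq_zero htest)
  filter_upwards [this] with x hx
  exact sub_eq_zero.1 hx

end Pieces

/-! ### Lattice sums and the gain of sub-exponential weights. -/

section LatticeSums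

variable {n : ℕ}

theorem one_le_norm_latticePoint {k : Fin n → ℤ} (hk : k ≠ 0) : 1 ≤ ‖latticePoint k‖ := by
  obtain ⟨i, hi⟩ := Function.ne_iff.1 hk
  refine le_trans ?_ (PiLp.norm_apply_le (latticePoint k) i)
  rw [latticePoint_apply, Real.norm_eq_abs]
  exact_mod_cast Int.one_le_abs hi

theorem summable_norm_latticePoint_rpow :
    Summable fun k : Fin n → ℤ => ‖latticePoint k‖ ^ (-((n : ℝ) + 1)) := by
  let b := (EuclideanSpace.basisFun (Fin n) ℝ).toBasis
  have hmem : ∀ k : Fin n → ℤ, latticePoint k ∈ Submodule.span ℤ (Set.range b) := by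
    intro k
    have : latticePoint k = ∑ i, k i • b i := by
      ext j
      simp [b, Pi.single_apply]
    rw [this]
    exact Submodule.sum_mem _ fun i _ => Submodule.smul_mem _ _ (Submodule.subset_span ⟨i, rfl⟩)
  have hs := ZLattice.summable_norm_rpow (Submodule.span ℤ (Set.range b)) (-((n : ℝ) + 1)) (by
    rw [ZLattice.rank ℝ]
    simp)
  have hinj : Function.Injective fun k : Fin n → ℤ =>
      (⟨latticePoint k, hmem k⟩ : Submodule.span ℤ (Set.range b)) := by
    intro k l hkl
    have h : latticePoint k = latticePoint l := congrArg Subtype.val hkl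
    ext i
    have := congrArg (fun v : EuclideanSpace ℝ (Fin n) => v i) h
    simpa using this
  have h := hs.comp_injective hinj
  simp only [Function.comp_def, Submodule.coe_norm] at h
  exact h

theorem summable_exp_neg_mul_rpow {c α : ℝ} (hc : 0 < c) (hα : 0 < α) :
    Summable fun k : Fin n → ℤ => Real.exp (-(c * ‖latticePoint k‖ ^ α)) := by
  -- With `α m ≥ n + 1`, the bound `x ^ m / m! ≤ e ^ x` at `x = c t ^ α` beats the summable power.
  obtain ⟨m, hm⟩ := exists_nat_ge (((n : ℝ) + 1) / α)
  refine Summable.of_norm_bounded_eventually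
    ((summable_norm_latticePoint_rpow (n := n)).mul_left (m.factorial / c ^ m)) ?_
  -- The origin must be left out: there the power is `0` by convention while the exponential is `1`.
  have : ({0}ᶜ : Set (Fin n → ℤ)) ∈ Filter.cofinite := by simp
  filter_upwards [this] with k hk
  have h1 : 1 ≤ ‖latticePoint k‖ := one_le_norm_latticePoint hk
  set t := ‖latticePoint k‖
  have ht : 0 < t := by linarith
  rw [Real.norm_of_nonneg (Real.exp_pos _).le, Real.exp_neg, Real.rpow_neg ht.le]
  have h2 := Real.pow_div_factorial_le_exp (c * t ^ α) (by positivity) m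
  have h3 : t ^ ((n : ℝ) + 1) ≤ (t ^ α) ^ m := by
    rw [← Real.rpow_natCast (t ^ α), ← Real.rpow_mul ht.le]
    refine Real.rpow_le_rpow_of_exponent_le h1 ?_
    rw [div_le_iff₀ hα] at hm
    linarith
  have h4 : c ^ m * t ^ ((n : ℝ) + 1) / m.factorial ≤ Real.exp (c * t ^ α) := by
    refine le_trans ?_ h2
    rw [mul_pow]
    gcongr
  calc (Real.exp (c * t ^ α))⁻¹ ≤ (c ^ m * t ^ ((n : ℝ) + 1) / m.factorial)⁻¹ := by
        gcongr
    _ = _ := by field_simp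

/-- Bernoulli's `(1 + t)^α ≤ 1 + α t` at `t = b / a`, with `a^(α-1) ≤ b^(α-1)`. The factor `α < 1`
on the smaller term is the source of the gain. -/
theorem rpow_add_le_of_le {α a b : ℝ} (h0 : 0 < α) (h1 : α < 1) (hb : 0 ≤ b) (hab : b ≤ a) :
    (a + b) ^ α ≤ a ^ α + α * b ^ α := by
  rcases hb.eq_or_lt with rfl | hb'
  · simp [Real.zero_rpow h0.ne']
  have ha : 0 < a := hb'.trans_le hab
  have e : a + b = a * (1 + b / a) := by field_simp
  rw [e, Real.mul_rpow ha.le (by positivity)]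
  have h2 := rpow_one_add_le_one_add_mul_self (s := b / a) (p := α)
    (by linarith [div_nonneg hb ha.le]) h0.le h1.le
  have h3 : a ^ α * (b / a) ≤ b ^ α := by
    have h4 : a ^ (α - 1) ≤ b ^ (α - 1) := Real.rpow_le_rpow_of_nonpos hb' hab (by linarith)
    rw [Real.rpow_sub_one ha.ne', Real.rpow_sub_one hb'.ne'] at h4
    calc a ^ α * (b / a) = (a ^ α / a) * b := by ring
      _ ≤ (b ^ α / b) * b := by gcongr
      _ = b ^ α := by field_simp
  calc a ^ α * (1 + b / a) ^ α ≤ a ^ α * (1 + α * (b / a)) := by gcongr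
    _ = a ^ α + α * (a ^ α * (b / a)) := by ring
    _ ≤ _ := by gcongr

/-- The subadditivity gain of sub-exponential weights. -/
theorem exp_rpow_le_of_le_add {α a b d t : ℝ} (h0 : 0 < α) (h1 : α < 1) (ha : 0 ≤ a) (hb : 0 ≤ b)
    (hd : 0 ≤ d) (ht0 : 0 ≤ t) (ht : t ≤ a + b + d) :
    Real.exp (t ^ α) ≤ Real.exp (d ^ α) * (Real.exp (a ^ α) * Real.exp (b ^ α) *
      (Real.exp (-((1 - α) * a ^ α)) + Real.exp (-((1 - α) * b ^ α)))) := by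
  have h2 : t ^ α ≤ (a + b) ^ α + d ^ α :=
    (Real.rpow_le_rpow ht0 ht h0.le).trans (Real.rpow_add_le_add_rpow (by positivity) hd h0.le h1.le)
  have key : Real.exp ((a + b) ^ α) ≤ Real.exp (a ^ α) * Real.exp (b ^ α) *
      (Real.exp (-((1 - α) * a ^ α)) + Real.exp (-((1 - α) * b ^ α))) := by
    rcases le_total b a with h | h
    · calc Real.exp ((a + b) ^ α) ≤ Real.exp (a ^ α + b ^ α + -((1 - α) * b ^ α)) :=
            Real.exp_le_exp.2 ((rpow_add_le_of_le h0 h1 hb h).trans (by linarith))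
        _ = Real.exp (a ^ α) * Real.exp (b ^ α) * Real.exp (-((1 - α) * b ^ α)) := by
            rw [Real.exp_add, Real.exp_add]
        _ ≤ _ := by gcongr; linarith [Real.exp_pos (-((1 - α) * a ^ α))]
    · calc Real.exp ((a + b) ^ α) ≤ Real.exp (a ^ α + b ^ α + -((1 - α) * a ^ α)) := by
            refine Real.exp_le_exp.2 ?_
            rw [add_comm a b]
            exact (rpow_add_le_of_le h0 h1 ha h).trans (by linarith)
        _ = Real.exp (a ^ α) * Real.exp (b ^ α) * Real.exp (-((1 - α) * a ^ α)) := by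
            rw [Real.exp_add, Real.exp_add]
        _ ≤ _ := by gcongr; linarith [Real.exp_pos (-((1 - α) * b ^ α))]
  calc Real.exp (t ^ α) ≤ Real.exp (d ^ α + (a + b) ^ α) := Real.exp_le_exp.2 (by linarith)
    _ = Real.exp (d ^ α) * Real.exp ((a + b) ^ α) := Real.exp_add _ _
    _ ≤ _ := by gcongr

/-- The indicator of the cube of radius `3`, which bounds the interaction of frequencies. -/
noncomputable def cubeIndicator (r : Fin n → ℤ) : ℝ≥0∞ :=
  open scoped Classical in if ∀ i, |r i| ≤ 3 then 1 else 0

theorem tsum_cubeIndicator_ne_top : ∑' r : Fin n → ℤ, cubeIndicator r ≠ ⊤ := by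
  rw [tsum_eq_sum (s := Fintype.piFinset fun _ => Finset.Icc (-3) 3)]
  · refine (ENNReal.sum_lt_top.2 fun r _ => ?_).ne
    unfold cubeIndicator
    split_ifs <;> simp
  · intro r hr
    rw [cubeIndicator, if_neg]
    intro h
    refine hr ?_
    simp only [Fintype.mem_piFinset, Finset.mem_Icc]
    exact fun i => abs_le.1 (h i)

/-- The weight `e^(|k|^(1/s))`. -/
noncomputable def gevreyWeight (s : ℝ) (k : Fin n → ℤ) : ℝ≥0∞ :=
  ENNReal.ofReal (Real.exp (‖latticePoint k‖ ^ (1 / s)))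

/-- The square root of the gain in the subadditivity of the exponents `|k|^(1/s)`. -/
noncomputable def gain (s : ℝ) (k : Fin n → ℤ) : ℝ≥0∞ :=
  ENNReal.ofReal (Real.exp (-((1 - 1 / s) / 2 * ‖latticePoint k‖ ^ (1 / s))))

theorem tsum_gain_ne_top {s : ℝ} (hs : 1 < s) : ∑' k : Fin n → ℤ, gain s k ≠ ⊤ := by
  have h1 : 1 / s < 1 := by rw [div_lt_one (by linarith)]; exact hs
  have := summable_exp_neg_mul_rpow (n := n) (c := (1 - 1 / s) / 2) (α := 1 / s) (by linarith)
    (by positivity)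
  simp only [gain]
  exact this.tsum_ofReal_ne_top

theorem tsum_inv_gevreyWeight_ne_top {s : ℝ} (hs : 1 < s) :
    ∑' k : Fin n → ℤ, (gevreyWeight s k)⁻¹ ≠ ⊤ := by
  have := summable_exp_neg_mul_rpow (n := n) (c := 1) (α := 1 / s) one_pos (by positivity)
  simp_rw [gevreyWeight, ← ENNReal.ofReal_inv_of_pos (Real.exp_pos _), ← Real.exp_neg]
  simp only [one_mul] at this
  exact this.tsum_ofReal_ne_top

/-- On the cube `|m| ≤ |k| + |l| + d`, where `d` bounds the finitely many lattice points of the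
cube; off the cube both sides vanish. -/
theorem exists_gevreyWeight_le (n : ℕ) {s : ℝ} (hs : 1 < s) :
    ∃ C : ℝ≥0∞, C ≠ ⊤ ∧ ∀ m k l : Fin n → ℤ,
      gevreyWeight s m * cubeIndicator (m - k - l) ≤
        C * (cubeIndicator (m - k - l) *
          (gevreyWeight s k * gevreyWeight s l * (gain s k ^ 2 + gain s l ^ 2))) := by
  have h1 : 1 / s < 1 := by rw [div_lt_one (by linarith)]; exact hs
  have h0 : 0 < 1 / s := by positivity
  obtain ⟨d, hd0, hd⟩ : ∃ d : ℝ, 0 ≤ d ∧ ∀ r : Fin n → ℤ, (∀ i, |r i| ≤ 3) →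
      ‖latticePoint r‖ ≤ d := by
    refine ⟨∑ r ∈ Fintype.piFinset fun _ : Fin n => Finset.Icc (-3 : ℤ) 3, ‖latticePoint r‖,
      by positivity, fun r hr => ?_⟩
    refine Finset.single_le_sum (f := fun r => ‖latticePoint r‖) (fun _ _ => norm_nonneg _) ?_
    simp only [Fintype.mem_piFinset, Finset.mem_Icc]
    exact fun i => abs_le.1 (hr i)
  refine ⟨ENNReal.ofReal (Real.exp (d ^ (1 / s))), ENNReal.ofReal_ne_top, fun m k l => ?_⟩
  by_cases hr : ∀ i, |(m - k - l) i| ≤ 3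
  · have hc : cubeIndicator (m - k - l) = 1 := if_pos hr
    have hsq : ∀ k : Fin n → ℤ, gain s k ^ 2
        = ENNReal.ofReal (Real.exp (-((1 - 1 / s) * ‖latticePoint k‖ ^ (1 / s)))) := fun k => by
      rw [gain, ← ENNReal.ofReal_pow (Real.exp_pos _).le, ← Real.exp_nat_mul]
      congr 2
      push_cast
      ring
    rw [hc, mul_one, one_mul, hsq, hsq, gevreyWeight, gevreyWeight, gevreyWeight,
      ← ENNReal.ofReal_add (by positivity) (by positivity), ← ENNReal.ofReal_mul (by positivity),
      ← ENNReal.ofReal_mul (by positivity), ← ENNReal.ofReal_mul (by positivity)]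
    refine ENNReal.ofReal_le_ofReal (exp_rpow_le_of_le_add h0 h1 (norm_nonneg _) (norm_nonneg _)
      hd0 (norm_nonneg _) ?_)
    have e : latticePoint m = latticePoint k + latticePoint l + latticePoint (m - k - l) := by
      rw [← latticePoint_add, ← latticePoint_add]
      congr 1
      abel
    rw [e]
    exact (norm_add₃_le).trans (by gcongr; exact hd _ hr)
  · have hc : cubeIndicator (m - k - l) = 0 := if_neg hr
    simp [hc]

/-- Substituting `l = m - k - r`, one factor `η k` stays with `a k`, which is then bounded by the
full sum; the other makes a convolution with `b`. -/
theorem tsum_tsum_cubeIndicator_le (η a b : (Fin n → ℤ) → ℝ≥0∞) (m : Fin n → ℤ) :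
    ∑' k, ∑' l, cubeIndicator (m - k - l) * (η k ^ 2 * (a k * b l)) ≤
      (∑' k, η k * a k) * ∑' k, ∑' r, η k * cubeIndicator r * b (m - k - r) := by
  rw [← ENNReal.tsum_mul_left]
  refine ENNReal.tsum_le_tsum fun k => ?_
  rw [← (Equiv.subLeft (m - k)).tsum_eq]
  simp only [Equiv.subLeft_apply, sub_sub_cancel]
  calc ∑' r, cubeIndicator r * (η k ^ 2 * (a k * b (m - k - r)))
      = (η k * a k) * ∑' r, η k * cubeIndicator r * b (m - k - r) := by
        rw [← ENNReal.tsum_mul_left]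
        refine tsum_congr fun r => ?_
        ring
    _ ≤ _ := by gcongr; exact ENNReal.le_tsum (f := fun k => η k * a k) k

end LatticeSums

/-! ### Products of pieces. -/

section Products

open FourierTransform

variable {n : ℕ} {ρ : EuclideanSpace ℝ (Fin n) → ℝ} {f g : EuclideanSpace ℝ (Fin n) → ℂ}

/-- Two uses of Fubini reduce to three kernels. Cubic decay of the first kernel absorbs the growth
`weight⁻¹` of a piece and leaves the `weight ^ 2` required by `Tame.integral_mul_conv`. -/
theorem integral_kernel_mul_conv_mul_conv_eq_zero (hρ : IsWindow ρ) (hf : Tame f) (hg : Tame g)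
    {m k l : Fin n → ℤ} (h : ¬ ∀ i, |m i - k i - l i| ≤ 3) (x : EuclideanSpace ℝ (Fin n)) :
    ∫ y, kernel hρ m (x - y) * conv (kernel hρ k) f y * conv (kernel hρ l) g y = 0 := by
  obtain ⟨C, hC0, hC⟩ := exists_norm_kernel_le hρ 3
  obtain ⟨B, hB0, hB⟩ := exists_norm_kernel_le hρ 0
  obtain ⟨A, hA0, hA⟩ := hf.exists_norm_conv_le (kernel hρ k)
  have hw : ∀ y, C * weight (x - y) ^ 3 ≤ C * (weight x)⁻¹ ^ 3 * weight y ^ 3 := fun y => by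
    rw [mul_assoc, ← mul_pow]
    have := weight_pos (x - y)
    gcongr
    exact weight_sub_le x y
  have hm : Continuous fun y => kernel hρ m (x - y) := (kernel hρ m).continuous.comp (by fun_prop)
  have hzero : ∀ w, ∫ y, kernel hρ m (x - y) * conv (kernel hρ k) f y * kernel hρ l (y - w)
      = 0 := by
    intro w
    have hswap : ∀ y, kernel hρ m (x - y) * conv (kernel hρ k) f y * kernel hρ l (y - w)
        = (kernel hρ m (x - y) * kernel hρ l (y - w)) * conv (kernel hρ k) f y := fun y => by ring
    simp_rw [hswap]
    rw [hf.integral_mul_conv (kernel hρ k)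
      (S := fun y => kernel hρ m (x - y) * kernel hρ l (y - w))
      (C := C * (weight x)⁻¹ ^ 3 * B)
      (hm.mul ((kernel hρ l).continuous.comp (by fun_prop))).aestronglyMeasurable]
    · have h' : ¬ ∀ i, |m i - l i - k i| ≤ 3 := by
        simpa only [sub_right_comm] using h
      simp_rw [integral_kernel_mul_kernel_mul_kernel_eq_zero hρ h']
      simp
    · intro y
      rw [norm_mul]
      have h1 := weight_pos y
      have h2 := weight_pos x
      calc _ ≤ (C * (weight x)⁻¹ ^ 3 * weight y ^ 3) * (B * 1) := by
            refine mul_le_mul ((hC m _).trans (hw y)) ?_ (norm_nonneg _) (by positivity)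
            simpa using hB l (y - w)
        _ = (C * (weight x)⁻¹ ^ 3 * B) * (weight y ^ 2 * weight y) := by ring
        _ ≤ (C * (weight x)⁻¹ ^ 3 * B) * (weight y ^ 2 * 1) := by
            gcongr
            exact weight_le_one y
        _ = _ := by ring
  rw [hg.integral_mul_conv (kernel hρ l)
    (S := fun y => kernel hρ m (x - y) * conv (kernel hρ k) f y)
    (C := C * (weight x)⁻¹ ^ 3 * A)
    (hm.aestronglyMeasurable.mul
      (aestronglyMeasurable_conv (kernel hρ k).continuous hf.aestronglyMeasurable))]
  · simp_rw [hzero]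
    simp
  · intro y
    rw [norm_mul]
    have h1 := weight_pos y
    have h2 := weight_pos x
    calc _ ≤ (C * (weight x)⁻¹ ^ 3 * weight y ^ 3) * (A * (weight y)⁻¹) :=
          mul_le_mul ((hC m _).trans (hw y)) (hA y) (norm_nonneg _) (by positivity)
      _ = _ := by field_simp

/-- Recentring the two pieces at `x` costs `(weight (x - y))⁻¹` each; cubic decay of the kernel
leaves one integrable weight. -/
theorem exists_enorm_integral_kernel_mul_le (hρ : IsWindow ρ) :
    ∃ M : ℝ≥0∞, M ≠ ⊤ ∧ ∀ f g : EuclideanSpace ℝ (Fin n) → ℂ, Tame f → Tame g → ∀ m k l x,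
      ‖∫ y, kernel hρ m (x - y) * conv (kernel hρ k) f y * conv (kernel hρ l) g y‖ₑ ≤
        M * (cubeIndicator (m - k - l) *
          (smear (conv (kernel hρ k) f) x * smear (conv (kernel hρ l) g) x)) := by
  obtain ⟨B, hB0, hB⟩ := exists_norm_kernel_le hρ 3
  obtain ⟨C, hC0, hC⟩ := exists_enorm_conv_le_smear hρ
  refine ⟨ENNReal.ofReal (B * C * C) * weightMass (EuclideanSpace ℝ (Fin n)),
    ENNReal.mul_ne_top ENNReal.ofReal_ne_top weightMass_ne_top, fun f g hf hg m k l x => ?_⟩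
  by_cases hr : ∀ i, |m i - k i - l i| ≤ 3
  · have hc : cubeIndicator (m - k - l) = 1 := if_pos hr
    rw [hc, one_mul]
    set F := smear (conv (kernel hρ k) f) x
    set G := smear (conv (kernel hρ l) g) x
    calc _ ≤ ∫⁻ y, ‖kernel hρ m (x - y) * conv (kernel hρ k) f y * conv (kernel hρ l) g y‖ₑ :=
          enorm_integral_le_lintegral_enorm _
      _ ≤ ∫⁻ y, ENNReal.ofReal (weight (x - y)) * (ENNReal.ofReal (B * C * C) * (F * G)) := by
          gcongr with y
          have hw := weight_pos (x - y)
          have h1 : ‖kernel hρ m (x - y)‖ₑ ≤ ENNReal.ofReal (B * weight (x - y) ^ 3) := by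
            rw [← ofReal_norm]
            exact ENNReal.ofReal_le_ofReal (hB m _)
          rw [enorm_mul, enorm_mul]
          calc _ ≤ ENNReal.ofReal (B * weight (x - y) ^ 3) *
                (ENNReal.ofReal (C * (weight (x - y))⁻¹) * F) *
                (ENNReal.ofReal (C * (weight (x - y))⁻¹) * G) := by
                gcongr
                · exact hC f hf k x y
                · exact hC g hg l x y
            _ = ENNReal.ofReal (B * weight (x - y) ^ 3 * (C * (weight (x - y))⁻¹) *
                  (C * (weight (x - y))⁻¹)) * (F * G) := by
                rw [ENNReal.ofReal_mul (p := B * weight (x - y) ^ 3 * (C * (weight (x - y))⁻¹))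
                  (by positivity), ENNReal.ofReal_mul (p := B * weight (x - y) ^ 3)
                  (by positivity)]
                ring
            _ = ENNReal.ofReal (weight (x - y) * (B * C * C)) * (F * G) := by
                congr 2
                field_simp
            _ = _ := by
                rw [ENNReal.ofReal_mul hw.le, mul_assoc]
      _ = _ := by
          have hm : Measurable fun y => ENNReal.ofReal (weight (x - y)) :=
            measurable_weight_sub.of_uncurry_left
          rw [lintegral_mul_const _ hm, lintegral_weight_sub_left, ← mul_assoc,
            mul_comm (weightMass _)]
  · rw [integral_kernel_mul_conv_mul_conv_eq_zero hρ hf hg hr]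
    simp

/-- Summable suprema make the double series converge absolutely under the integral, so it may be
integrated term by term. -/
theorem enorm_conv_mul_le (hρ : IsWindow ρ) (hf : Tame f) (hg : Tame g)
    {b c : (Fin n → ℤ) → ℝ} (hb : Summable b) (hc : Summable c)
    (hfb : ∀ k x, ‖conv (kernel hρ k) f x‖ ≤ b k) (hgc : ∀ k x, ‖conv (kernel hρ k) g x‖ ≤ c k)
    (hfs : f =ᵐ[volume] fun x => ∑' k, conv (kernel hρ k) f x)
    (hgs : g =ᵐ[volume] fun x => ∑' k, conv (kernel hρ k) g x) (m : Fin n → ℤ)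
    (x : EuclideanSpace ℝ (Fin n)) :
    ‖conv (kernel hρ m) (fun y => f y * g y) x‖ₑ ≤ ∑' k, ∑' l,
      ‖∫ y, kernel hρ m (x - y) * conv (kernel hρ k) f y * conv (kernel hρ l) g y‖ₑ := by
  have hb0 : ∀ k, 0 ≤ b k := fun k => (norm_nonneg _).trans (hfb k 0)
  have hc0 : ∀ k, 0 ≤ c k := fun k => (norm_nonneg _).trans (hgc k 0)
  have hbc : Summable fun p : (Fin n → ℤ) × (Fin n → ℤ) => b p.1 * c p.2 :=
    hb.mul_of_nonneg hc hb0 hc0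
  have hK : Integrable fun y => ‖kernel hρ m (x - y)‖ :=
    ((kernel hρ m).integrable (μ := volume)).norm.comp_sub_left x
  have hbound : ∀ (p : (Fin n → ℤ) × (Fin n → ℤ)) y,
      ‖kernel hρ m (x - y) * conv (kernel hρ p.1) f y * conv (kernel hρ p.2) g y‖ ≤
        ‖kernel hρ m (x - y)‖ * (b p.1 * c p.2) := fun p y => by
    rw [norm_mul, norm_mul, mul_assoc]
    gcongr
    · exact hb0 _
    · exact hfb _ y
    · exact hgc _ y
  have hint : ∀ p : (Fin n → ℤ) × (Fin n → ℤ), Integrable fun y =>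
      kernel hρ m (x - y) * conv (kernel hρ p.1) f y * conv (kernel hρ p.2) g y := fun p => by
    refine (hK.mul_const (b p.1 * c p.2)).mono' ?_ (.of_forall (hbound p))
    exact (((kernel hρ m).continuous.comp (by fun_prop)).aestronglyMeasurable.mul
      (aestronglyMeasurable_conv (kernel hρ p.1).continuous hf.aestronglyMeasurable)).mul
      (aestronglyMeasurable_conv (kernel hρ p.2).continuous hg.aestronglyMeasurable)
  have hsum := hasSum_integral_of_summable_integral_norm hint (by
    refine Summable.of_nonneg_of_le (fun p => integral_nonneg fun z => norm_nonneg _)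
      (fun p => ?_) (hbc.mul_left (∫ y, ‖kernel hρ m (x - y)‖))
    rw [← integral_mul_const]
    exact integral_mono (hint p).norm (hK.mul_const _) (hbound p))
  have heq : conv (kernel hρ m) (fun y => f y * g y) x = ∑' p : (Fin n → ℤ) × (Fin n → ℤ),
      ∫ y, kernel hρ m (x - y) * conv (kernel hρ p.1) f y * conv (kernel hρ p.2) g y := by
    rw [hsum.tsum_eq, conv]
    refine integral_congr_ae ?_
    filter_upwards [hfs, hgs] with y hfy hgy
    simp only [mul_assoc]
    rw [tsum_mul_left]
    congr 1
    rw [hfy, hgy]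
    refine tsum_mul_tsum_of_summable_norm ?_ ?_
    · exact Summable.of_nonneg_of_le (fun _ => norm_nonneg _) (fun k => hfb k y) hb
    · exact Summable.of_nonneg_of_le (fun _ => norm_nonneg _) (fun k => hgc k y) hc
  rw [heq, ← ENNReal.tsum_prod (f := fun k l =>
    ‖∫ y, kernel hρ m (x - y) * conv (kernel hρ k) f y * conv (kernel hρ l) g y‖ₑ)]
  exact enorm_tsum_le_tsum_enorm

end Products

/-! ### The pointwise product estimate and the norm inequality. -/

section Algebra

variable {n : ℕ} {ρ : EuclideanSpace ℝ (Fin n) → ℝ} {f g : EuclideanSpace ℝ (Fin n) → ℂ}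

theorem gevreyNorm_eq_of_memLp (hρ : IsWindow ρ) {p : ℝ≥0∞} (hp : 1 ≤ p) (hf : MemLp f p volume)
    (s : ℝ) (r q : ℝ≥0∞) : gevreyNorm ρ s r q f =
      seqNorm q fun k => gevreyWeight s k * eLpNorm (conv (kernel hρ k) f) r volume := by
  obtain ⟨u, hu⟩ := exists_represents_of_memLp hp hf
  exact hu.gevreyNorm_eq hρ (Tame.of_memLp hp hf) s r q

/-- Each weighted piece is at most the whole norm, and the inverse weights are summable. -/
theorem MemGevrey.exists_summable_bound (hρ : IsWindow ρ) {s : ℝ} (hs : 1 < s) {p q : ℝ≥0∞}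
    (hp : 1 ≤ p) (hq : 1 ≤ q) (hf : MemGevrey ρ s p q f) :
    ∃ b : (Fin n → ℤ) → ℝ, Summable b ∧ ∀ k x, ‖conv (kernel hρ k) f x‖ ≤ b k := by
  obtain ⟨D, hD0, hD⟩ := exists_enorm_conv_le_eLpNorm hρ p hp
  have hX := hf.2
  rw [gevreyNorm_eq_of_memLp hρ hp hf.1] at hX
  set X := seqNorm q fun k => gevreyWeight s k * eLpNorm (conv (kernel hρ k) f) p volume with hXdef
  have hbound : ∀ k, eLpNorm (conv (kernel hρ k) f) p volume ≤ (gevreyWeight s k)⁻¹ * X := by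
    intro k
    have h0 : gevreyWeight s k ≠ 0 := by simp [gevreyWeight, Real.exp_pos]
    have ht : gevreyWeight s k ≠ ⊤ := ENNReal.ofReal_ne_top
    rw [← ENNReal.mul_le_iff_le_inv h0 ht]
    exact le_seqNorm hq _ k
  have hsum : ∑' k : Fin n → ℤ, D * ((gevreyWeight s k)⁻¹ * X) ≠ ⊤ := by
    rw [ENNReal.tsum_mul_left, ENNReal.tsum_mul_right]
    exact ENNReal.mul_ne_top hD0 (ENNReal.mul_ne_top (tsum_inv_gevreyWeight_ne_top hs) hX.ne)
  refine ⟨fun k => (D * ((gevreyWeight s k)⁻¹ * X)).toReal, ENNReal.summable_toReal hsum,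
    fun k x => ?_⟩
  rw [← toReal_enorm]
  refine ENNReal.toReal_mono (ENNReal.ne_top_of_tsum_ne_top hsum k) ?_
  exact (hD f (Tame.of_memLp hp hf.1) k x).trans (by gcongr; exact hbound k)

theorem aemeasurable_smear_conv (hρ : IsWindow ρ) (hf : Tame f) (k : Fin n → ℤ) :
    AEMeasurable (smear (conv (kernel hρ k) f)) :=
  aemeasurable_smear
    (aestronglyMeasurable_conv (kernel hρ k).continuous hf.aestronglyMeasurable)

theorem eLpNorm_const_mul_smear_conv_le (hρ : IsWindow ρ) (hf : Tame f) {p : ℝ≥0∞} (hp : 1 ≤ p)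
    (c : ℝ≥0∞) (k : Fin n → ℤ) :
    eLpNorm (fun x => c * smear (conv (kernel hρ k) f) x) p volume ≤
      weightMass (EuclideanSpace ℝ (Fin n)) * (c * eLpNorm (conv (kernel hρ k) f) p volume) := by
  rw [eLpNorm_const_mul_ennreal (aemeasurable_smear_conv hρ hf k)]
  have := eLpNorm_smear_le
    (aestronglyMeasurable_conv (kernel hρ k).continuous hf.aestronglyMeasurable) hp
  calc _ ≤ c * (weightMass (EuclideanSpace ℝ (Fin n)) *
        eLpNorm (conv (kernel hρ k) f) p volume) := by gcongr
    _ = _ := by ring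

/-- The sum of the weighted pieces, damped by the gain. -/
noncomputable def dampedSum (hρ : IsWindow ρ) (s : ℝ) (f : EuclideanSpace ℝ (Fin n) → ℂ)
    (x : EuclideanSpace ℝ (Fin n)) : ℝ≥0∞ :=
  ∑' k, gain s k * (gevreyWeight s k * smear (conv (kernel hρ k) f) x)

/-- The discrete convolution of the weighted pieces with the gain, spread over a cube. -/
noncomputable def dampedConv (hρ : IsWindow ρ) (s : ℝ) (f : EuclideanSpace ℝ (Fin n) → ℂ)
    (m : Fin n → ℤ) (x : EuclideanSpace ℝ (Fin n)) : ℝ≥0∞ :=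
  ∑' k, ∑' r, gain s k * cubeIndicator r *
    (gevreyWeight s (m - k - r) * smear (conv (kernel hρ (m - k - r)) f) x)

theorem aemeasurable_dampedSum (hρ : IsWindow ρ) (s : ℝ) (hf : Tame f) :
    AEMeasurable (dampedSum hρ s f) :=
  AEMeasurable.tsum fun k =>
    ((aemeasurable_smear_conv hρ hf k).const_mul _).const_mul _

theorem aemeasurable_dampedConv (hρ : IsWindow ρ) (s : ℝ) (hf : Tame f) (m : Fin n → ℤ) :
    AEMeasurable (dampedConv hρ s f m) :=
  AEMeasurable.tsum fun _ => AEMeasurable.tsum fun _ =>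
    ((aemeasurable_smear_conv hρ hf _).const_mul _).const_mul _

/-- Minkowski, with `ℓ^q ⊆ ℓ^∞` for the pieces and summability left to the gain. -/
theorem eLpNorm_dampedSum_le (hρ : IsWindow ρ) (s : ℝ) (hf : Tame f) {p q : ℝ≥0∞} (hp : 1 ≤ p)
    (hq : 1 ≤ q) : eLpNorm (dampedSum hρ s f) p volume ≤
      (∑' k : Fin n → ℤ, gain s k) * weightMass (EuclideanSpace ℝ (Fin n)) *
        seqNorm q fun k => gevreyWeight s k * eLpNorm (conv (kernel hρ k) f) p volume := by
  have hm : ∀ k, AEMeasurable fun x => gevreyWeight s k * smear (conv (kernel hρ k) f) x :=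
    fun k => (aemeasurable_smear_conv hρ hf k).const_mul _
  refine (eLpNorm_tsum_le (fun k => (hm k).const_mul (gain s k)) hp).trans ?_
  rw [mul_assoc, ← ENNReal.tsum_mul_right]
  refine ENNReal.tsum_le_tsum fun k => ?_
  rw [eLpNorm_const_mul_ennreal (hm k)]
  gcongr
  refine (eLpNorm_const_mul_smear_conv_le hρ hf hp _ k).trans ?_
  gcongr
  exact le_seqNorm hq (fun k => gevreyWeight s k * eLpNorm (conv (kernel hρ k) f) p volume) k

/-- Young's inequality `ℓ^1 * ℓ^q ⊆ ℓ^q`, from Minkowski and translation invariance of the `ℓ^q`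
norm. -/
theorem seqNorm_eLpNorm_dampedConv_le (hρ : IsWindow ρ) (s : ℝ) (hf : Tame f) {p q : ℝ≥0∞}
    (hp : 1 ≤ p) (hq : 1 ≤ q) : seqNorm q (fun m => eLpNorm (dampedConv hρ s f m) p volume) ≤
      (∑' k : Fin n → ℤ, gain s k) * (∑' r : Fin n → ℤ, cubeIndicator r) *
        weightMass (EuclideanSpace ℝ (Fin n)) *
        seqNorm q fun k => gevreyWeight s k * eLpNorm (conv (kernel hρ k) f) p volume := by
  set a : (Fin n → ℤ) → ℝ≥0∞ :=
    fun k => gevreyWeight s k * eLpNorm (conv (kernel hρ k) f) p volume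
  set w := weightMass (EuclideanSpace ℝ (Fin n))
  have hm : ∀ k, AEMeasurable fun x => gevreyWeight s k * smear (conv (kernel hρ k) f) x :=
    fun k => (aemeasurable_smear_conv hρ hf k).const_mul _
  have h1 : ∀ m, eLpNorm (dampedConv hρ s f m) p volume ≤
      ∑' k, ∑' r, gain s k * cubeIndicator r * w * a (m - k - r) := by
    intro m
    refine (eLpNorm_tsum_le (fun k => AEMeasurable.tsum fun r => (hm _).const_mul _) hp).trans ?_
    refine ENNReal.tsum_le_tsum fun k => ?_
    refine (eLpNorm_tsum_le (fun r => (hm _).const_mul _) hp).trans ?_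
    refine ENNReal.tsum_le_tsum fun r => ?_
    rw [eLpNorm_const_mul_ennreal (hm _), mul_assoc _ w]
    gcongr
    exact eLpNorm_const_mul_smear_conv_le hρ hf hp _ _
  calc seqNorm q (fun m => eLpNorm (dampedConv hρ s f m) p volume)
      ≤ seqNorm q fun m => ∑' k, ∑' r, gain s k * cubeIndicator r * w * a (m - k - r) :=
        seqNorm_mono h1
    _ ≤ ∑' k, ∑' r, seqNorm q fun m => gain s k * cubeIndicator r * w * a (m - k - r) :=
        (seqNorm_tsum_le hq _).trans (ENNReal.tsum_le_tsum fun k => seqNorm_tsum_le hq _)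
    _ = ∑' k, ∑' r, gain s k * cubeIndicator r * w * seqNorm q a := by
        refine tsum_congr fun k => tsum_congr fun r => ?_
        rw [seqNorm_const_mul hq]
        congr 1
        simp_rw [sub_sub]
        exact seqNorm_comp_equiv q a (Equiv.subRight (k + r))
    _ = _ := by
        simp_rw [ENNReal.tsum_mul_right, ENNReal.tsum_mul_left, ENNReal.tsum_mul_right]

/-- The two terms correspond to the gain falling on the frequency of `f` or on that of `g`. -/
theorem exists_gevreyWeight_mul_enorm_conv_mul_le (hρ : IsWindow ρ) {s : ℝ} (hs : 1 < s) :
    ∃ M : ℝ≥0∞, M ≠ ⊤ ∧ ∀ f g : EuclideanSpace ℝ (Fin n) → ℂ, Tame f → Tame g →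
      ∀ b c : (Fin n → ℤ) → ℝ, Summable b → Summable c →
      (∀ k x, ‖conv (kernel hρ k) f x‖ ≤ b k) → (∀ k x, ‖conv (kernel hρ k) g x‖ ≤ c k) →
      (f =ᵐ[volume] fun x => ∑' k, conv (kernel hρ k) f x) →
      (g =ᵐ[volume] fun x => ∑' k, conv (kernel hρ k) g x) → ∀ m x,
      gevreyWeight s m * ‖conv (kernel hρ m) (fun y => f y * g y) x‖ₑ ≤
        M * (dampedSum hρ s f x * dampedConv hρ s g m x +
          dampedSum hρ s g x * dampedConv hρ s f m x) := by
  obtain ⟨M, hM0, hM⟩ := exists_enorm_integral_kernel_mul_le hρ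
  obtain ⟨C, hC0, hC⟩ := exists_gevreyWeight_le n hs
  refine ⟨M * C, ENNReal.mul_ne_top hM0 hC0, fun f g hf hg b c hb hc hfb hgc hfs hgs m x => ?_⟩
  set F : (Fin n → ℤ) → ℝ≥0∞ := fun k => smear (conv (kernel hρ k) f) x
  set G : (Fin n → ℤ) → ℝ≥0∞ := fun k => smear (conv (kernel hρ k) g) x
  set W : (Fin n → ℤ) → ℝ≥0∞ := gevreyWeight s
  set η : (Fin n → ℤ) → ℝ≥0∞ := gain s
  have hterm : ∀ k l, W m * (M * (cubeIndicator (m - k - l) * (F k * G l))) ≤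
      M * C * (cubeIndicator (m - k - l) * (η k ^ 2 * ((W k * F k) * (W l * G l))) +
        cubeIndicator (m - l - k) * (η l ^ 2 * ((W l * G l) * (W k * F k)))) := by
    intro k l
    rw [sub_right_comm m l k]
    calc _ = M * (F k * G l) * (W m * cubeIndicator (m - k - l)) := by ring
      _ ≤ M * (F k * G l) * (C * (cubeIndicator (m - k - l) *
            (W k * W l * (η k ^ 2 + η l ^ 2)))) := mul_le_mul_right (hC m k l) _
      _ = _ := by ring
  calc _ ≤ W m * ∑' k, ∑' l, M * (cubeIndicator (m - k - l) * (F k * G l)) := by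
        gcongr
        refine (enorm_conv_mul_le hρ hf hg hb hc hfb hgc hfs hgs m x).trans ?_
        gcongr with k l
        exact hM f g hf hg m k l x
    _ = ∑' k, ∑' l, W m * (M * (cubeIndicator (m - k - l) * (F k * G l))) := by
        simp_rw [ENNReal.tsum_mul_left]
    _ ≤ ∑' k, ∑' l,
          M * C * (cubeIndicator (m - k - l) * (η k ^ 2 * ((W k * F k) * (W l * G l))) +
            cubeIndicator (m - l - k) * (η l ^ 2 * ((W l * G l) * (W k * F k)))) := by
        exact ENNReal.tsum_le_tsum fun k => ENNReal.tsum_le_tsum fun l => hterm k l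
    _ = M * C * ((∑' k, ∑' l,
            cubeIndicator (m - k - l) * (η k ^ 2 * ((W k * F k) * (W l * G l)))) +
          ∑' l, ∑' k, cubeIndicator (m - l - k) * (η l ^ 2 * ((W l * G l) * (W k * F k)))) := by
        simp_rw [ENNReal.tsum_mul_left, ENNReal.tsum_add]
        congr 2
        exact ENNReal.tsum_comm
    _ ≤ _ := by
        gcongr
        · exact tsum_tsum_cubeIndicator_le η (fun k => W k * F k) (fun l => W l * G l) m
        · exact tsum_tsum_cubeIndicator_le η (fun l => W l * G l) (fun k => W k * F k) m

theorem exists_gevreyNorm_mul_le (hρ : IsWindow ρ) {s : ℝ} (hs : 1 < s) {q : ℝ≥0∞} (hq : 1 ≤ q) :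
    ∃ C : ℝ≥0∞, C ≠ ⊤ ∧ ∀ p₁ p₂ p : ℝ≥0∞, 1 ≤ p₁ → 1 ≤ p₂ → p⁻¹ = p₁⁻¹ + p₂⁻¹ →
      ∀ f g : EuclideanSpace ℝ (Fin n) → ℂ, MemGevrey ρ s p₁ q f → MemGevrey ρ s p₂ q g →
        gevreyNorm ρ s p q (fun x => f x * g x) ≤
          C * gevreyNorm ρ s p₁ q f * gevreyNorm ρ s p₂ q g := by
  obtain ⟨M, hM0, hM⟩ := exists_gevreyWeight_mul_enorm_conv_mul_le hρ hs
  set w := weightMass (EuclideanSpace ℝ (Fin n))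
  set S := ∑' k : Fin n → ℤ, gain s k
  set R := ∑' r : Fin n → ℤ, cubeIndicator r
  have hw : w ≠ ⊤ := weightMass_ne_top
  have hS : S ≠ ⊤ := tsum_gain_ne_top hs
  have hR : R ≠ ⊤ := tsum_cubeIndicator_ne_top
  -- The factor `4` is the quasi-triangle constant `2` times the two symmetric terms.
  refine ⟨4 * (M * ((S * w) * (S * R * w))), by finiteness,
    fun p₁ p₂ p hp₁ hp₂ hp f g hf hg => ?_⟩
  have hft := Tame.of_memLp hp₁ hf.1
  have hgt := Tame.of_memLp hp₂ hg.1
  obtain ⟨b, hb, hfb⟩ := hf.exists_summable_bound hρ hs hp₁ hq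
  obtain ⟨c, hc, hgc⟩ := hg.exists_summable_bound hρ hs hp₂ hq
  obtain ⟨u, hu⟩ := exists_represents_of_memLp hp₁ hf.1
  obtain ⟨v, hv⟩ := exists_represents_of_memLp hp₂ hg.1
  have hfs := hu.ae_eq_tsum_conv hρ hft hb hfb
  have hgs := hv.ae_eq_tsum_conv hρ hgt hc hgc
  -- Boundedness of `f` puts the product in `L^{p₂}` with `p₂ ≥ 1`, so it represents a distribution
  -- even if `p < 1`.
  have hf_top : MemLp f ⊤ := (memLp_congr_ae hfs).2 (memLp_top_tsum_conv hρ hft hb hfb)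
  have hfg : MemLp (fun x => f x * g x) p₂ := hg.1.mul' hf_top
  rw [gevreyNorm_eq_of_memLp hρ hp₂ hfg, gevreyNorm_eq_of_memLp hρ hp₁ hf.1,
    gevreyNorm_eq_of_memLp hρ hp₂ hg.1]
  set X := seqNorm q fun k => gevreyWeight s k * eLpNorm (conv (kernel hρ k) f) p₁ volume
  set Y := seqNorm q fun k => gevreyWeight s k * eLpNorm (conv (kernel hρ k) g) p₂ volume
  have hp2 : p⁻¹ ≤ 2 := by
    rw [hp, ← one_add_one_eq_two]
    exact add_le_add (ENNReal.inv_le_one.2 hp₁) (ENNReal.inv_le_one.2 hp₂)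
  have hp' : p⁻¹ = p₂⁻¹ + p₁⁻¹ := by rw [hp, add_comm]
  have hPf := aemeasurable_dampedSum hρ s hft
  have hPg := aemeasurable_dampedSum hρ s hgt
  have hQf := aemeasurable_dampedConv hρ s hft
  have hQg := aemeasurable_dampedConv hρ s hgt
  have hm : ∀ m, gevreyWeight s m * eLpNorm (conv (kernel hρ m) fun x => f x * g x) p volume ≤
      M * (2 * ((S * w * X) * eLpNorm (dampedConv hρ s g m) p₂ volume +
        (S * w * Y) * eLpNorm (dampedConv hρ s f m) p₁ volume)) := by
    intro m
    have hcm := aestronglyMeasurable_conv (kernel hρ m).continuous hfg.1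
    rw [← eLpNorm_enorm (conv _ _), ← eLpNorm_const_mul_ennreal hcm.enorm]
    calc _ ≤ eLpNorm (fun x => M * (dampedSum hρ s f x * dampedConv hρ s g m x +
          dampedSum hρ s g x * dampedConv hρ s f m x)) p volume :=
          eLpNorm_mono_enorm fun x => hM f g hft hgt b c hb hc hfb hgc hfs hgs m x
      _ = M * eLpNorm (fun x => dampedSum hρ s f x * dampedConv hρ s g m x +
          dampedSum hρ s g x * dampedConv hρ s f m x) p volume :=
          eLpNorm_const_mul_ennreal ((hPf.mul (hQg m)).add (hPg.mul (hQf m))) _ _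
      _ ≤ _ := by
          gcongr
          refine (eLpNorm_add_le_two_mul (hPf.mul (hQg m)) (hPg.mul (hQf m)) hp2).trans ?_
          gcongr
          · refine (eLpNorm_mul_le_ennreal hPf (hQg m) hp₁ hp₂ hp).trans ?_
            gcongr
            exact eLpNorm_dampedSum_le hρ s hft hp₁ hq
          · refine (eLpNorm_mul_le_ennreal hPg (hQf m) hp₂ hp₁ hp').trans ?_
            gcongr
            exact eLpNorm_dampedSum_le hρ s hgt hp₂ hq
  calc _ ≤ seqNorm q fun m => M * (2 * ((S * w * X) * eLpNorm (dampedConv hρ s g m) p₂ volume +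
        (S * w * Y) * eLpNorm (dampedConv hρ s f m) p₁ volume)) := seqNorm_mono hm
    _ ≤ M * (2 * ((S * w * X) * (S * R * w * Y) + (S * w * Y) * (S * R * w * X))) := by
        rw [seqNorm_const_mul hq, seqNorm_const_mul hq]
        gcongr
        refine (seqNorm_add_le hq _ _).trans ?_
        rw [seqNorm_const_mul hq, seqNorm_const_mul hq]
        gcongr
        · exact seqNorm_eLpNorm_dampedConv_le hρ s hgt hp₂ hq
        · exact seqNorm_eLpNorm_dampedConv_le hρ s hft hp₁ hq
    _ = _ := by ring

end Algebra

end GevreyModulation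

theorem mainTheorem1 {n : ℕ} (ρ : EuclideanSpace ℝ (Fin n) → ℝ)
    (hρ : GevreyModulation.IsWindow ρ) (s : ℝ) (hs : 1 < s) (q : ℝ≥0∞) (hq : 1 ≤ q) :
    ∃ C : ℝ, 0 < C ∧
      ∀ p₁ p₂ p : ℝ≥0∞, 1 ≤ p₁ → 1 ≤ p₂ → p⁻¹ = p₁⁻¹ + p₂⁻¹ →
        ∀ f g : EuclideanSpace ℝ (Fin n) → ℂ,
          GevreyModulation.MemGevrey ρ s p₁ q f → GevreyModulation.MemGevrey ρ s p₂ q g →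
            GevreyModulation.MemGevrey ρ s p q (fun x => f x * g x) ∧
              GevreyModulation.gevreyNorm ρ s p q (fun x => f x * g x) ≤
                ENNReal.ofReal C * GevreyModulation.gevreyNorm ρ s p₁ q f *
                  GevreyModulation.gevreyNorm ρ s p₂ q g := by
  obtain ⟨C, hC, h⟩ := GevreyModulation.exists_gevreyNorm_mul_le hρ hs hq
  -- Adding `1` makes the real constant strictly positive.
  have hle : C ≤ ENNReal.ofReal (C.toReal + 1) :=
    (ENNReal.ofReal_toReal hC).symm.le.trans (ENNReal.ofReal_le_ofReal (by linarith))
  refine ⟨C.toReal + 1, by positivity, fun p₁ p₂ p hp₁ hp₂ hp f g hf hg => ?_⟩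
  have hmain := h p₁ p₂ p hp₁ hp₂ hp f g hf hg
  have : ENNReal.HolderTriple p₁ p₂ p := ⟨hp.symm⟩
  refine ⟨⟨hg.1.mul' hf.1, hmain.trans_lt ?_⟩, hmain.trans (by gcongr)⟩
  exact ENNReal.mul_lt_top (ENNReal.mul_lt_top hC.lt_top hf.2) hg.2
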